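/- All graphs are finite, simple and undirected. Let $G$ be a 2-connected outerplane graph, and let $x \neq y$ be vertices of $G$ such that $G$ is $xy$-fundamental, i.e. the fundamental $x$-$y$ subgraph of $G$ is $G$ itself; here the fundamental $x$-$y$ subgraph is the edge $xy$ if $xy \in E(G)$, and otherwise it is the subgraph of $G$ induced by the vertices of the inner faces on the shortest path in the weak dual of $G$ between faces on which $x$ and $y$ lie (the weak dual has the inner faces as its vertices, two of them being adjacent when they share an edge). Suppose that $G$ has exactly one non-triangular inner face $F$, that neither $x$ nor $y$ lies on $F$, and that $a, b, c$ are three distinct vertices of $F$ such that $F$ has two distinct neighbouring inner faces (i.e. inner faces sharing an edge with $F$), one containing $a$ and $b$ and the other containing $a$ and $c$; the vertex $a$ is called the apex of $F$. Let $G'$ be the subgraph of $G$ obtained by deleting the path that connects $b$ and $c$ on the boundary of $F$ and avoids $a$ (that is, its internal vertices, which are the vertices of $F$ other than $a$, $b$, $c$), and let $C \colon V(G') \to \{1,2,3\}$ be any proper 3-colouring of $G'$. Let $$P(G) = \prod_{uv \in E(G),\ u<v} (u - v) \in \mathbb{Z}[V(G)]$$ be the graph polynomial of $G$, where the vertices are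 the variables and $<$ fixes an arbitrary orientation of the edges of $G$. Then $P(G)$ contains a monomial with non-zero coefficient in which every variable other than $x$ and $y$ has exponent at most $2$ and 1. $x$ has exponent $1$ and $y$ has exponent $1$, if $C(x) = C(a) = C(y)$; 2. $x$ has exponent $0$ and $y$ has exponent $1$, if $C(x) \neq C(a) = C(y)$ or $C(x) = C(a) \neq C(y)$; 3. $x$ has exponent $0$ and $y$ has exponent $0$, if $C(x) \neq C(a)$ and $C(a) \neq C(y)$. -/

import Mathlib

/-!
2-connected outerplane graphs through combinatorial embeddings (rotation systems), their inner
faces and weak dual, `xy`-fundamental graphs, and the graph polynomial.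
-/

namespace OuterplaneGraph

universe u

variable {V : Type u}

/-- `G` is 2-connected: at least three vertices, connected, and without cutvertices. -/
def TwoConnected (G : SimpleGraph V) : Prop :=
  3 ≤ Nat.card V ∧ G.Connected ∧ ∀ v : V, (G.induce {w | w ≠ v}).Connected

/-- A rotation system of `G`: for every vertex `v` a cyclic order of the darts (oriented edges)
leaving `v`. The permutation `next` sends a dart to its successor around its initial vertex. -/
structure RotationSystem (G : SimpleGraph V) where
  next : Equiv.Perm G.Dart
  next_fst : ∀ d : G.Dart, (next d).fst = d.fst
  sameCycle : ∀ d e : G.Dart, d.fst = e.fst → next.SameCycle d e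

namespace RotationSystem

variable {G : SimpleGraph V}

/-- The permutation of the darts that follows the boundary of a face: traverse the dart `d`, then
turn into the dart following `d.symm` around the final vertex of `d`. -/
def facePerm (R : RotationSystem G) : Equiv.Perm G.Dart :=
  (Function.Involutive.toPerm SimpleGraph.Dart.symm SimpleGraph.Dart.symm_involutive).trans R.next

/-- The faces of the embedding of `G` given by a rotation system: the orbits of `facePerm`. -/
def Face (R : RotationSystem G) : Type u :=
  Quotient (Equiv.Perm.SameCycle.setoid R.facePerm)

/-- The face having the dart `d` on its boundary walk. -/
def faceOf (R : RotationSystem G) (d : G.Dart) : R.Face :=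
  Quotient.mk (Equiv.Perm.SameCycle.setoid R.facePerm) d

/-- The vertex `v` lies on (the boundary of) the face `f`. -/
def OnFace (R : RotationSystem G) (v : V) (f : R.Face) : Prop :=
  ∃ d : G.Dart, d.fst = v ∧ R.faceOf d = f

/-- The length of the boundary walk of a face. -/
noncomputable def faceLength (R : RotationSystem G) (f : R.Face) : ℕ :=
  Nat.card {d : G.Dart // R.faceOf d = f}

end RotationSystem

/-- An outerplane embedding of a connected graph `G` with at least one edge: an embedding in the
sphere, i.e. a rotation system of genus zero (`|V| - |E| + |F| = 2`), with a distinguished face,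
the outer one, on which all the vertices lie. -/
structure OuterplaneEmbedding (G : SimpleGraph V) extends RotationSystem G where
  euler : (Nat.card V : ℤ) - Nat.card G.edgeSet + Nat.card toRotationSystem.Face = 2
  outer : toRotationSystem.Face
  onFace_outer : ∀ v : V, toRotationSystem.OnFace v outer

namespace OuterplaneEmbedding

variable {G : SimpleGraph V}

/-- The inner faces: all faces except the outer one. -/
def InnerFace (R : OuterplaneEmbedding G) : Type u := {f : R.Face // f ≠ R.outer}

/-- The vertex `v` lies on the inner face `f`. -/
def OnInner (R : OuterplaneEmbedding G) (v : V) (f : R.InnerFace) : Prop := R.OnFace v f.1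

/-- The inner face `f` is a triangle. -/
def IsTriangular (R : OuterplaneEmbedding G) (f : R.InnerFace) : Prop := R.faceLength f.1 = 3

/-- The weak dual: its vertices are the inner faces, and two of them are adjacent when some edge
has one of them on each side. -/
def weakDual (R : OuterplaneEmbedding G) : SimpleGraph R.InnerFace where
  Adj f g := f ≠ g ∧ ∃ d : G.Dart, R.faceOf d = f.1 ∧ R.faceOf d.symm = g.1
  symm := ⟨by
    rintro f g ⟨hne, d, hf, hg⟩
    exact ⟨hne.symm, d.symm, hg, by simpa using hf⟩⟩
  loopless := ⟨fun _ h => h.1 rfl⟩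

/-- `p` is a shortest path in the weak dual between faces on which `x` and `y` lie. -/
def IsShortestBetween (R : OuterplaneEmbedding G) (x y : V) {f g : R.InnerFace}
    (p : R.weakDual.Walk f g) : Prop :=
  R.OnInner x f ∧ R.OnInner y g ∧
    ∀ (f' g' : R.InnerFace) (q : R.weakDual.Walk f' g'),
      R.OnInner x f' → R.OnInner y g' → p.length ≤ q.length

/-- The subgraph of `G` induced by the vertices lying on the faces of the walk `p`. -/
def subgraphAlong (R : OuterplaneEmbedding G) {f g : R.InnerFace}
    (p : R.weakDual.Walk f g) : G.Subgraph :=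
  (⊤ : G.Subgraph).induce {v | ∃ h ∈ p.support, R.OnInner v h}

/-- `G` is `xy`-fundamental: its fundamental `x-y` subgraph is all of `G`. The fundamental `x-y`
subgraph is the edge `xy` if `x` and `y` are adjacent, and otherwise it is the subgraph induced by
the vertices of the faces on the shortest path of the weak dual between faces on which `x` and `y`
lie (that path is unique when `G` is 2-connected and `x ≠ y` are not adjacent, the weak dual then
being a tree). -/
def IsFundamental (R : OuterplaneEmbedding G) (x y : V) : Prop :=
  (∀ h : G.Adj x y, G.subgraphOfAdj h = ⊤) ∧
    (¬ G.Adj x y → ∃ (f g : R.InnerFace) (p : R.weakDual.Walk f g),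
      R.IsShortestBetween x y p ∧ R.subgraphAlong p = ⊤)

/-- `a` is an apex of the inner face `F`, with companions `b` and `c`: the face `F` has two
neighbouring inner faces, one having the vertices `a`, `b` in common with `F` and the other one
having the vertices `a`, `c` in common with `F`. -/
def IsApex (R : OuterplaneEmbedding G) (F : R.InnerFace) (a b c : V) : Prop :=
  a ≠ b ∧ a ≠ c ∧ b ≠ c ∧ R.OnInner a F ∧ R.OnInner b F ∧ R.OnInner c F ∧
    ∃ f₁ f₂ : R.InnerFace, f₁ ≠ f₂ ∧ R.weakDual.Adj F f₁ ∧ R.weakDual.Adj F f₂ ∧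
      R.OnInner a f₁ ∧ R.OnInner b f₁ ∧ R.OnInner a f₂ ∧ R.OnInner c f₂

/-- The vertices that remain when the path connecting `b` and `c` on the boundary of `F` (the one
that avoids the apex `a`) is deleted: its internal vertices are the vertices of `F` other than
`a`, `b`, `c`. -/
def remaining (R : OuterplaneEmbedding G) (F : R.InnerFace) (a b c : V) : Set V :=
  {v | R.OnInner v F → v = a ∨ v = b ∨ v = c}

theorem apex_mem_remaining (R : OuterplaneEmbedding G) (F : R.InnerFace) (a b c : V) :
    a ∈ R.remaining F a b c := fun _ => Or.inl rfl

theorem mem_remaining (R : OuterplaneEmbedding G) (F : R.InnerFace) (a b c : V) {v : V}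
    (hv : ¬ R.OnInner v F) : v ∈ R.remaining F a b c := fun h => absurd h hv

end OuterplaneEmbedding

/-- The relation `r` orients `G`: for every edge `uv` exactly one of `r u v`, `r v u` holds. -/
def IsOrientation (G : SimpleGraph V) (r : V → V → Prop) : Prop :=
  ∀ u v : V, G.Adj u v → (r u v ↔ ¬ r v u)

open Classical in
/-- The graph polynomial of `G` with respect to the orientation `r`: the product of `u - v` over
all edges `uv` of `G` with `r u v`. -/
noncomputable def graphPolynomial [Fintype V] (G : SimpleGraph V) (r : V → V → Prop) :
    MvPolynomial V ℤ :=
  ∏ e : V × V with G.Adj e.1 e.2 ∧ r e.1 e.2, (MvPolynomial.X e.1 - MvPolynomial.X e.2)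

/-- `P` has a non-vanishing monomial in which `x` has exponent `i`, `y` has exponent `j`, and all
the other variables have exponent at most two. -/
def HasMonomial (P : MvPolynomial V ℤ) (x y : V) (i j : ℕ) : Prop :=
  ∃ m : V →₀ ℕ, MvPolynomial.coeff m P ≠ 0 ∧ m x = i ∧ m y = j ∧
    ∀ v : V, v ≠ x → v ≠ y → m v ≤ 2

end OuterplaneGraph

/-! The proof computes coefficients modulo two, where the orientation disappears and every edge `uv`
contributes `u + v`.

The central fact is `IsTwoTree.coeff_edgePoly`. A graph built from an edge by repeatedly attaching
triangles has `2|W| - 3` edges, so each of its monomials arises from the product of all squares by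
lowering exponents by a total of three. If no exponent exceeds two, the coefficient is odd exactly
when the colours of the lowered variables, taken in `ZMod 3`, do not sum to zero.

The shortest dual path makes the faces a chain. A count with Euler's formula (`IsFaceChain.tight`)
shows that the chain exhausts the inner faces and that each face meets its predecessors only in the
ends of one shared edge. Since `x` and `y` are off `F`, there are triangles on both sides of it.
Vertices of `F` other than `a`, `b`, `c` have degree at most two and can be deleted with exponent
equal to their current degree. What remains is two two-trees glued at `a`, and coefficients multiply
across the gluing.

It remains to distribute three lowerings over `x`, the apex and its companion on the side of `x`,
and three over `y`, the apex and the other companion, with both colour sums non-zero. The apex must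
be lowered at least twice in total, because it starts with exponent two from each side. -/

namespace OuterplaneGraph

open MvPolynomial

/-! ### Graph polynomials modulo two: deleting and gluing -/

section EdgePolynomial

variable {V : Type*}

/-- The factor `u + v` of the graph polynomial modulo two that belongs to the edge `uv`. -/
noncomputable def edgeFactor (e : Sym2 V) : MvPolynomial V (ZMod 2) :=
  Sym2.lift ⟨fun u v => X u + X v, fun _ _ => add_comm _ _⟩ e

/-- The graph polynomial modulo two of the graph with edge set `E`. -/
noncomputable def edgePoly (E : Finset (Sym2 V)) : MvPolynomial V (ZMod 2) :=
  ∏ e ∈ E, edgeFactor e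

@[simp]
theorem edgeFactor_mk (u v : V) : edgeFactor s(u, v) = X u + X v := rfl

/-- The polynomial `Q` does not involve the variable `w`. -/
def Avoids (Q : MvPolynomial V (ZMod 2)) (w : V) : Prop :=
  ∀ m : V →₀ ℕ, coeff m Q ≠ 0 → m w = 0

theorem Avoids.mul {P Q : MvPolynomial V (ZMod 2)} {w : V} (hP : Avoids P w) (hQ : Avoids Q w) :
    Avoids (P * Q) w := by
  classical
  intro m hm
  rw [coeff_mul] at hm
  obtain ⟨⟨i, j⟩, hij, hne⟩ := Finset.exists_ne_zero_of_sum_ne_zero hm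
  rw [Finset.HasAntidiagonal.mem_antidiagonal] at hij
  dsimp only at hij hne
  rw [← hij, Finsupp.add_apply, hP i (left_ne_zero_of_mul hne), hQ j (right_ne_zero_of_mul hne)]

theorem avoids_X {v w : V} (h : v ≠ w) : Avoids (X v) w := by
  classical
  intro m hm
  rw [coeff_X] at hm
  split_ifs at hm with h'
  · rw [← h', Finsupp.single_eq_of_ne h.symm]
  · exact absurd rfl hm

theorem Avoids.add {P Q : MvPolynomial V (ZMod 2)} {w : V} (hP : Avoids P w) (hQ : Avoids Q w) :
    Avoids (P + Q) w := by
  intro m hm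
  rw [coeff_add] at hm
  by_cases h : coeff m P = 0
  · exact hQ m fun h' => hm (by rw [h, h', add_zero])
  · exact hP m h

theorem avoids_one (w : V) : Avoids (1 : MvPolynomial V (ZMod 2)) w := by
  classical
  intro m hm
  rw [coeff_one] at hm
  split_ifs at hm with h'
  · rw [← h']; rfl
  · exact absurd rfl hm

theorem avoids_edgeFactor {e : Sym2 V} {w : V} (h : w ∉ e) : Avoids (edgeFactor e) w := by
  induction e with
  | h u v =>
    rw [Sym2.mem_iff, not_or] at h
    exact (avoids_X (Ne.symm h.1)).add (avoids_X (Ne.symm h.2))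

theorem avoids_edgePoly {E : Finset (Sym2 V)} {w : V} (h : ∀ e ∈ E, w ∉ e) :
    Avoids (edgePoly E) w := by
  classical
  induction E using Finset.induction_on with
  | empty => simpa [edgePoly] using avoids_one w
  | insert e E he ih =>
    rw [edgePoly, Finset.prod_insert he]
    exact (avoids_edgeFactor (h e (Finset.mem_insert_self e E))).mul
      (ih fun e' he' => h e' (Finset.mem_insert_of_mem he'))

/-- This separates the terms of an expansion in powers of `w`, as needed when a vertex is attached
to a two-tree. -/
theorem coeff_X_pow_mul_of_avoids {Q : MvPolynomial V (ZMod 2)} {w : V} (hQ : Avoids Q w)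
    {M : V →₀ ℕ} (hM : M w = 0) (k l : ℕ) :
    coeff (Finsupp.single w k + M) (X w ^ l * Q) = if k = l then coeff M Q else 0 := by
  classical
  rw [X_pow_eq_monomial, coeff_monomial_mul']
  split_ifs with h1 h2 h2
  · subst h2
    rw [add_tsub_cancel_left, one_mul]
  · rw [one_mul]
    by_contra hne
    have h3 := hQ _ hne
    have h4 := h1 w
    simp [hM] at h3 h4
    omega
  · subst h2
    exact absurd le_self_add h1
  · rfl

/-- A vertex whose exponent equals its degree can be deleted. -/
theorem coeff_edgePoly_delete [DecidableEq V] (E : Finset (Sym2 V)) (hE : ∀ e ∈ E, ¬ e.IsDiag)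
    (v : V) (M : V →₀ ℕ) (hM : M v = 0) :
    coeff (Finsupp.single v (E.filter (v ∈ ·)).card + M) (edgePoly E) =
      coeff M (edgePoly (E.filter (v ∉ ·))) := by
  -- The factors at `v` are multiplied in one by one. The bound on the exponent of `v` is carried
  -- along because it rules out choosing `u` from a factor `v + u` when the top power of `v` is
  -- wanted.
  have key : ∀ S : Finset (Sym2 V), (∀ e ∈ S, ¬ e.IsDiag ∧ v ∈ e) →
      ∀ (Q : MvPolynomial V (ZMod 2)), Avoids Q v →
        (∀ m, coeff m (edgePoly S * Q) ≠ 0 → m v ≤ S.card) ∧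
        ∀ m, m v = 0 → coeff (Finsupp.single v S.card + m) (edgePoly S * Q) = coeff m Q := by
    intro S
    induction S using Finset.induction_on with
    | empty =>
      intro _ Q hQ
      simpa [edgePoly] using fun m hm => hQ m hm
    | insert e S he ih =>
      intro hS Q hQ
      obtain ⟨h1, h2⟩ := ih (fun e' he' => hS e' (Finset.mem_insert_of_mem he')) Q hQ
      obtain ⟨hd, hv⟩ := hS e (Finset.mem_insert_self e S)
      obtain ⟨u, rfl⟩ := Sym2.mem_iff_exists.1 hv
      have hu : u ≠ v := fun h => hd (by simp [h])
      have hP : edgePoly (insert s(v, u) S) * Q =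
          X v * (edgePoly S * Q) + X u * (edgePoly S * Q) := by
        rw [edgePoly, Finset.prod_insert he, edgeFactor_mk, edgePoly]
        ring
      rw [hP, Finset.card_insert_of_notMem he]
      refine ⟨fun m hm => ?_, fun m hm => ?_⟩
      · by_contra hlt
        refine hm ?_
        rw [coeff_add, coeff_X_mul', coeff_X_mul']
        have hz : ∀ w, coeff (m - Finsupp.single w 1) (edgePoly S * Q) = 0 := by
          intro w
          by_contra hne
          have h3 := h1 _ hne
          have h4 : (Finsupp.single w 1 : V →₀ ℕ) v ≤ 1 := by
            rw [Finsupp.single_apply]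
            split_ifs <;> omega
          rw [Finsupp.tsub_apply] at h3
          omega
        simp [hz]
      · have h3 : Finsupp.single v (S.card + 1) + m =
            Finsupp.single v 1 + (Finsupp.single v S.card + m) := by
          rw [← add_assoc, ← Finsupp.single_add, add_comm 1]
        rw [coeff_add, h3, coeff_X_mul, h2 m hm, coeff_X_mul']
        split_ifs
        · rw [add_eq_left]
          by_contra hne
          have h4 := h1 _ hne
          simp [Finsupp.single_eq_of_ne hu.symm, hm] at h4
        · exact add_zero _
  have hQ : Avoids (edgePoly (E.filter (v ∉ ·))) v :=
    avoids_edgePoly fun e he => (Finset.mem_filter.1 he).2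
  rw [← ((key (E.filter (v ∈ ·)) (fun e he => by
    rw [Finset.mem_filter] at he
    exact ⟨hE e he.1, he.2⟩) _ hQ).2 M hM)]
  congr 1
  exact (Finset.prod_filter_mul_prod_filter_not E (v ∈ ·) edgeFactor).symm

/-- Vertices of degree at most two can be deleted from a graph: a non-vanishing monomial of the
rest extends to one of the whole graph with exponents at most two at the deleted vertices. -/
theorem exists_coeff_edgePoly_ne_zero [DecidableEq V] (E : Finset (Sym2 V))
    (hE : ∀ e ∈ E, ¬ e.IsDiag) (S : Finset V) (hS : ∀ v ∈ S, (E.filter (v ∈ ·)).card ≤ 2)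
    (M : V →₀ ℕ) (hM : ∀ v ∈ S, M v = 0)
    (hne : coeff M (edgePoly (E.filter fun e => ∀ v ∈ S, v ∉ e)) ≠ 0) :
    ∃ M' : V →₀ ℕ, coeff M' (edgePoly E) ≠ 0 ∧ (∀ v ∉ S, M' v = M v) ∧ ∀ v ∈ S, M' v ≤ 2 := by
  induction S using Finset.induction_on generalizing M with
  | empty => exact ⟨M, by simpa using hne, fun _ _ => rfl, by simp⟩
  | insert v S hv ih =>
    -- The vertex `v` is removed from the graph left after `S`, with its degree there as exponent.
    -- The induction hypothesis then restores `S`.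
    set E' := E.filter fun e => ∀ v ∈ S, v ∉ e with hE'
    have h1 : (E.filter fun e => ∀ u ∈ insert v S, u ∉ e) = E'.filter (v ∉ ·) := by
      ext e
      simp only [hE', Finset.mem_filter, Finset.forall_mem_insert]
      tauto
    rw [h1, ← coeff_edgePoly_delete E' (fun e he => hE e (Finset.mem_filter.1 he).1) v M
      (hM v (Finset.mem_insert_self v S))] at hne
    have hle : (E'.filter (v ∈ ·)).card ≤ 2 :=
      (Finset.card_le_card (Finset.filter_subset_filter _ (Finset.filter_subset _ _))).trans
        (hS v (Finset.mem_insert_self v S))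
    obtain ⟨M', hM', h2, h3⟩ := ih (fun u hu => hS u (Finset.mem_insert_of_mem hu)) _
      (fun u hu => by
        have : u ≠ v := fun h => hv (h ▸ hu)
        simp [hM u (Finset.mem_insert_of_mem hu), this]) hne
    refine ⟨M', hM', fun u hu => ?_, fun u hu => ?_⟩
    · rw [Finset.mem_insert, not_or] at hu
      rw [h2 u hu.2]
      simp [hu.1]
    · rcases Finset.mem_insert.1 hu with rfl | hu
      · rw [h2 u hv]
        simpa [hM u (Finset.mem_insert_self u S)] using hle
      · exact h3 u hu

theorem isHomogeneous_edgePoly (E : Finset (Sym2 V)) : (edgePoly E).IsHomogeneous E.card := by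
  rw [Finset.card_eq_sum_ones]
  refine IsHomogeneous.prod _ _ _ fun e _ => ?_
  induction e with
  | h u v => exact (isHomogeneous_X _ u).add (isHomogeneous_X _ v)

/-- Coefficients are multiplicative when two graphs are glued at a single vertex. -/
theorem coeff_edgePoly_mul (E₁ E₂ : Finset (Sym2 V)) (a : V)
    (h : ∀ v, v ≠ a → (∃ e ∈ E₁, v ∈ e) → ¬ ∃ e ∈ E₂, v ∈ e) (M₁ M₂ : V →₀ ℕ)
    (hM₁ : coeff M₁ (edgePoly E₁) ≠ 0) (hM₂ : coeff M₂ (edgePoly E₂) ≠ 0) :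
    coeff (M₁ + M₂) (edgePoly E₁ * edgePoly E₂) ≠ 0 := by
  classical
  have hom : ∀ (E : Finset (Sym2 V)) {m : V →₀ ℕ}, coeff m (edgePoly E) ≠ 0 →
      m.degree = E.card := fun E m hm => by
    have := isHomogeneous_edgePoly E hm
    rwa [show (1 : V → ℕ) = fun _ => 1 from rfl, ← Finsupp.degree_eq_weight_one] at this
  -- Only one splitting contributes: a variable other than `a` occurs in at most one factor, which
  -- fixes its exponents, and homogeneity then fixes those of `a`.
  rw [coeff_mul, Finset.sum_eq_single (M₁, M₂)]
  · exact mul_ne_zero hM₁ hM₂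
  · rintro ⟨m₁, m₂⟩ hm hne
    rw [Finset.HasAntidiagonal.mem_antidiagonal] at hm
    dsimp only at hm ⊢
    by_contra hcon
    have h1 := left_ne_zero_of_mul hcon
    have h2 := right_ne_zero_of_mul hcon
    have hv : ∀ v, v ≠ a → m₁ v = M₁ v := by
      intro v hva
      have hs := DFunLike.congr_fun hm v
      simp only [Finsupp.add_apply] at hs
      by_cases hE : ∃ e ∈ E₁, v ∈ e
      · have hE₂ : ∀ e ∈ E₂, v ∉ e := fun e he hve => h v hva hE ⟨e, he, hve⟩
        rw [avoids_edgePoly hE₂ _ h2, avoids_edgePoly hE₂ _ hM₂] at hs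
        omega
      · have hE₁ : ∀ e ∈ E₁, v ∉ e := fun e he hve => hE ⟨e, he, hve⟩
        rw [avoids_edgePoly hE₁ _ h1, avoids_edgePoly hE₁ _ hM₁]
    have hdeg : m₁.degree = M₁.degree := (hom E₁ h1).trans (hom E₁ hM₁).symm
    have he : m₁.erase a = M₁.erase a := by
      ext v
      by_cases hva : v = a
      · simp [hva]
      · simp [Finsupp.erase_ne hva, hv v hva]
    have ha : m₁ a = M₁ a := by
      rw [← Finsupp.single_add_erase a m₁, ← Finsupp.single_add_erase a M₁, he] at hdeg
      simpa using hdeg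
    have hm₁ : m₁ = M₁ := by
      ext v
      by_cases hva : v = a
      · rw [hva, ha]
      · exact hv v hva
    subst hm₁
    exact hne (by rw [add_left_cancel hm])
  · intro hcon
    rw [Finset.HasAntidiagonal.mem_antidiagonal] at hcon
    exact absurd rfl hcon

end EdgePolynomial

/-! ### Coefficients of two-trees through three-colourings -/

section TwoTree

variable {V : Type*}

/-- Two-trees, given by their vertices and edges: starting with an edge, one attaches triangles
along edges. -/
inductive IsTwoTree [DecidableEq V] : Finset V → Finset (Sym2 V) → Prop
  | edge (p q : V) : p ≠ q → IsTwoTree {p, q} {s(p, q)}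
  | attach (W : Finset V) (E : Finset (Sym2 V)) (p q w : V) : IsTwoTree W E → s(p, q) ∈ E →
      w ∉ W → IsTwoTree (insert w W) (insert s(w, p) (insert s(w, q) E))

theorem IsTwoTree.mem_of_mem [DecidableEq V] {W : Finset V} {E : Finset (Sym2 V)} (h : IsTwoTree W E)
    {e : Sym2 V} (he : e ∈ E) {v : V} (hv : v ∈ e) : v ∈ W := by
  induction h generalizing e v with
  | edge p q hpq =>
    rw [Finset.mem_singleton] at he
    subst he
    simpa using hv
  | attach W E p q w h hpq hw ih =>
    rw [Finset.mem_insert, Finset.mem_insert] at he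
    have hp := ih hpq (Sym2.mem_mk_left p q)
    have hq := ih hpq (Sym2.mem_mk_right p q)
    rcases he with rfl | rfl | he
    · rcases Sym2.mem_iff.1 hv with rfl | rfl <;> simp [hp]
    · rcases Sym2.mem_iff.1 hv with rfl | rfl <;> simp [hq]
    · exact Finset.mem_insert_of_mem (ih he hv)

/-- The sum of the colours of the elements of the multiset `D`. -/
noncomputable def colourSum (C : V → ZMod 3) : (V →₀ ℕ) →ₗ[ℕ] ZMod 3 :=
  Finsupp.linearCombination ℕ C

/-- The element of `ZMod 2` telling whether `z` is non-zero. -/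
def indicatorNe (z : ZMod 3) : ZMod 2 := if z = 0 then 0 else 1

/-- The exponents of the monomial in which each variable of `W` is squared. -/
noncomputable def squares (W : Finset V) : V →₀ ℕ := ∑ v ∈ W, Finsupp.single v 2

theorem squares_apply [DecidableEq V] (W : Finset V) (v : V) : squares W v = if v ∈ W then 2 else 0 := by
  simp [squares, Finsupp.finsetSum_apply, Finsupp.single_apply]

theorem colourSum_single (C : V → ZMod 3) (v : V) (n : ℕ) :
    colourSum C (Finsupp.single v n) = n * C v := by
  simp [colourSum]

theorem eq_single_of_degree {D : V →₀ ℕ} {p : V} (h : D.degree = D p) :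
    D = Finsupp.single p (D p) := by
  have h1 := Finsupp.single_add_erase p D
  have h2 : D.degree = (Finsupp.single p (D p)).degree + (D.erase p).degree := by
    rw [← map_add, h1]
  rw [Finsupp.degree_single] at h2
  have h3 : (D.erase p).degree = 0 := by omega
  rw [Finsupp.degree_eq_zero_iff] at h3
  rw [h3, add_zero] at h1
  exact h1.symm

/-- The coefficients modulo two of the graph polynomial of a two-tree: the coefficient of the
monomial that arises from the product of the squares of the variables by lowering the exponents
by `D` tells whether the colours of `D` have a non-zero sum. -/
theorem IsTwoTree.coeff_edgePoly [DecidableEq V] {W : Finset V} {E : Finset (Sym2 V)} (h : IsTwoTree W E)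
    {C : V → ZMod 3} (hC : ∀ p q, s(p, q) ∈ E → C p ≠ C q) {M D : V →₀ ℕ}
    (hMD : M + D = squares W) (hD : D.degree = 3) :
    coeff M (edgePoly E) = indicatorNe (colourSum C D) := by
  induction h generalizing M D with
  | edge p q hpq =>
    have hne := hC p q (Finset.mem_singleton_self _)
    have hval := fun v => DFunLike.congr_fun hMD v
    simp only [Finsupp.add_apply, squares_apply, Finset.mem_insert, Finset.mem_singleton] at hval
    have hrep : ∀ m : V →₀ ℕ, (∀ v, v ≠ p → v ≠ q → m v = 0) →
        m = Finsupp.single p (m p) + Finsupp.single q (m q) := by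
      intro m hm
      ext v
      by_cases hp : v = p
      · subst hp; simp [hpq]
      · by_cases hq : v = q
        · subst hq; simp [hpq]
        · simp [hp, hq, hm v hp hq]
    have hM := hrep M fun v hp hq => by have := hval v; simp [hp, hq] at this; exact this.1
    have hD' := hrep D fun v hp hq => by have := hval v; simp [hp, hq] at this; exact this.2
    have hp := hval p
    have hq := hval q
    simp only [true_or, or_true, if_true] at hp hq
    rw [hD', map_add, Finsupp.degree_single, Finsupp.degree_single] at hD
    rw [hD', map_add, colourSum_single, colourSum_single, hM, edgePoly, Finset.prod_singleton,
      edgeFactor_mk, coeff_add, coeff_X, coeff_X]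
    -- The colour sums here are `C p + 2 C q` and `2 C p + C q`, which are plus or minus `C p - C q`
    -- in `ZMod 3`.
    have hcase : (M p = 1 ∧ D p = 1 ∧ M q = 0 ∧ D q = 2) ∨
        (M p = 0 ∧ D p = 2 ∧ M q = 1 ∧ D q = 1) := by omega
    have h1 : ∀ s t : ZMod 3, s ≠ t → ((1 : ℕ) : ZMod 3) * s + ((2 : ℕ) : ZMod 3) * t ≠ 0 := by
      decide
    have h2 : ∀ s t : ZMod 3, s ≠ t → ((2 : ℕ) : ZMod 3) * s + ((1 : ℕ) : ZMod 3) * t ≠ 0 := by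
      decide
    rcases hcase with ⟨e1, e2, e3, e4⟩ | ⟨e1, e2, e3, e4⟩
    · rw [e1, e2, e3, e4, indicatorNe, if_neg (h1 _ _ hne)]
      simp [Finsupp.single_left_inj, hpq.symm]
    · rw [e1, e2, e3, e4, indicatorNe, if_neg (h2 _ _ hne)]
      simp [Finsupp.single_left_inj, hpq]
  | attach W E p q w h hpq hw ih =>
    have hCE : ∀ p q, s(p, q) ∈ E → C p ≠ C q := fun p q he =>
      hC p q (Finset.mem_insert_of_mem (Finset.mem_insert_of_mem he))
    have hp : p ∈ W := h.mem_of_mem hpq (Sym2.mem_mk_left p q)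
    have hq : q ∈ W := h.mem_of_mem hpq (Sym2.mem_mk_right p q)
    have hwp : w ≠ p := fun h => hw (h ▸ hp)
    have hwq : w ≠ q := fun h => hw (h ▸ hq)
    have c1 := hCE p q hpq
    have hne : p ≠ q := fun h => c1 (by rw [h])
    have c2 := hC w p (Finset.mem_insert_self _ _)
    have c3 := hC w q (Finset.mem_insert_of_mem (Finset.mem_insert_self _ _))
    have one : ∀ r ∈ W, ∀ M' D' : V →₀ ℕ, M' + D' = squares W → D'.degree = 2 →
        coeff M' (X r * edgePoly E) = indicatorNe (colourSum C (D' + Finsupp.single r 1)) := by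
      intro r hr M' D' hMD' hD'
      have hval := DFunLike.congr_fun hMD' r
      rw [Finsupp.add_apply, squares_apply, if_pos hr] at hval
      rw [coeff_X_mul']
      split_ifs with hs
      · rw [Finsupp.mem_support_iff] at hs
        have hle : Finsupp.single r 1 ≤ M' := by
          rw [Finsupp.single_le_iff]; omega
        refine ih hCE ?_ (by rw [map_add, hD', Finsupp.degree_single])
        rw [← hMD', add_comm D', ← add_assoc, tsub_add_cancel_of_le hle]
      -- If `M'` lacks `r`, the coefficient is zero and `D'` is twice `r`. The formula survives
      -- because three times a colour vanishes.
      · rw [Finsupp.notMem_support_iff] at hs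
        have h2 : D' r = 2 := by omega
        rw [eq_single_of_degree (hD'.trans h2.symm), h2, ← Finsupp.single_add, colourSum_single]
        have : ((2 + 1 : ℕ) : ZMod 3) = 0 := by decide
        rw [this, zero_mul]
        rfl
    have two : ∀ M' D' : V →₀ ℕ, M' + D' = squares W → D'.degree = 1 →
        coeff M' (X p * (X q * edgePoly E)) =
          indicatorNe (colourSum C (D' + Finsupp.single p 1 + Finsupp.single q 1)) := by
      intro M' D' hMD' hD'
      have hval := DFunLike.congr_fun hMD' p
      rw [Finsupp.add_apply, squares_apply, if_pos hp] at hval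
      have hle1 : D' p ≤ 1 := hD' ▸ Finsupp.le_degree p D'
      have hle : Finsupp.single p 1 ≤ M' := by
        rw [Finsupp.single_le_iff]; omega
      rw [coeff_X_mul', if_pos (by rw [Finsupp.mem_support_iff]; omega)]
      refine one q hq _ _ ?_ (by rw [map_add, hD', Finsupp.degree_single])
      rw [← hMD', add_comm D', ← add_assoc, tsub_add_cancel_of_le hle]
    have hQ : Avoids (edgePoly E) w := avoids_edgePoly fun e he hwe => hw (h.mem_of_mem he hwe)
    have hwE : ∀ r, s(w, r) ∉ E := fun r hr => hw (h.mem_of_mem hr (Sym2.mem_mk_left w r))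
    -- Expanding `(w + p)(w + q)`: the exponent of `w` in the monomial selects one of the three
    -- terms.
    have hP : edgePoly (insert s(w, p) (insert s(w, q) E)) = X w ^ 2 * edgePoly E +
        X w ^ 1 * (X p * edgePoly E + X q * edgePoly E) +
        X w ^ 0 * (X p * (X q * edgePoly E)) := by
      rw [edgePoly, Finset.prod_insert, Finset.prod_insert (hwE q), edgeFactor_mk, edgeFactor_mk,
        edgePoly]
      · ring
      · rw [Finset.mem_insert, not_or]
        exact ⟨fun h => hne (Sym2.congr_right.1 h), hwE p⟩
    have hMw : M = Finsupp.single w (M w) + M.erase w := (Finsupp.single_add_erase w M).symm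
    have hDw : D = Finsupp.single w (D w) + D.erase w := (Finsupp.single_add_erase w D).symm
    set M' := M.erase w with hM'
    set D' := D.erase w with hD'
    have hM'w : M' w = 0 := Finsupp.erase_same
    have hw2 := DFunLike.congr_fun hMD w
    rw [Finsupp.add_apply, squares_apply, if_pos (Finset.mem_insert_self w W)] at hw2
    have hMD' : M' + D' = squares W := by
      ext v
      have hv := DFunLike.congr_fun hMD v
      rw [Finsupp.add_apply, squares_apply] at hv ⊢
      by_cases hvw : v = w
      · subst hvw
        rw [if_neg hw, hM', hD', Finsupp.erase_same, Finsupp.erase_same, add_zero]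
      · rw [hM', hD', Finsupp.erase_ne hvw, Finsupp.erase_ne hvw, hv]
        simp [hvw]
    rw [hDw, map_add, Finsupp.degree_single] at hD
    have hXp := avoids_X (V := V) hwp.symm
    have hXq := avoids_X (V := V) hwq.symm
    rw [hP, hMw, coeff_add, coeff_add, coeff_X_pow_mul_of_avoids hQ hM'w,
      coeff_X_pow_mul_of_avoids ((hXp.mul hQ).add (hXq.mul hQ)) hM'w,
      coeff_X_pow_mul_of_avoids (hXp.mul (hXq.mul hQ)) hM'w, hDw, map_add, colourSum_single]
    have hcase : (M w = 2 ∧ D w = 0) ∨ (M w = 1 ∧ D w = 1) ∨ (M w = 0 ∧ D w = 2) := by omega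
    rcases hcase with ⟨e1, e2⟩ | ⟨e1, e2⟩ | ⟨e1, e2⟩
    · rw [e2, zero_add] at hD
      simp [e1, e2, ih hCE hMD' hD]
    · rw [e2] at hD
      have hD2 : D'.degree = 2 := by omega
      -- As `s`, `t`, `u` are all the colours, exactly one of `z + s`, `z + t`, `z + u` is zero, so
      -- the three indicators sum to two, which is zero in `ZMod 2`.
      have key : ∀ z s t u : ZMod 3, s ≠ t → u ≠ s → u ≠ t →
          indicatorNe (z + ((1 : ℕ) : ZMod 3) * s) + indicatorNe (z + ((1 : ℕ) : ZMod 3) * t) =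
            indicatorNe (((1 : ℕ) : ZMod 3) * u + z) := by decide
      simp only [e1, e2, one_ne_zero, if_true, if_false, coeff_add, one p hp M' D' hMD' hD2,
        one q hq M' D' hMD' hD2, map_add, colourSum_single, ← key _ _ _ _ c1 c2 c3]
      simp
    · rw [e2] at hD
      have hD1 : D'.degree = 1 := by omega
      -- The three colours sum to zero, hence `s + t = 2u`.
      have key : ∀ z s t u : ZMod 3, s ≠ t → u ≠ s → u ≠ t →
          indicatorNe (z + ((1 : ℕ) : ZMod 3) * s + ((1 : ℕ) : ZMod 3) * t) =
            indicatorNe (((2 : ℕ) : ZMod 3) * u + z) := by decide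
      simp only [e1, e2, if_true, two M' D' hMD' hD1, map_add, colourSum_single,
        ← key _ _ _ _ c1 c2 c3]
      simp

end TwoTree

/-! ### Reduction modulo two -/

open Classical in
theorem map_graphPolynomial {V : Type*} [Fintype V] (G : SimpleGraph V) {r : V → V → Prop}
    (hr : IsOrientation G r) :
    MvPolynomial.map (Int.castRingHom (ZMod 2)) (graphPolynomial G r) =
      edgePoly G.edgeFinset := by
  rw [graphPolynomial, map_prod, edgePoly]
  refine Finset.prod_bij (fun e _ => s(e.1, e.2)) ?_ ?_ ?_ ?_
  · intro e he
    rw [Finset.mem_filter] at he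
    simpa using he.2.1
  · rintro ⟨u, v⟩ he ⟨u', v'⟩ he' h
    simp only [Finset.mem_filter, Finset.mem_univ, true_and] at he he'
    rw [Sym2.eq_iff] at h
    rcases h with ⟨rfl, rfl⟩ | ⟨rfl, rfl⟩
    · rfl
    · exact absurd he'.2 ((hr _ _ he.1).1 he.2)
  · intro e he
    induction e with
    | h u v =>
      rw [SimpleGraph.mem_edgeFinset, SimpleGraph.mem_edgeSet] at he
      by_cases h : r u v
      · exact ⟨(u, v), by simp [he, h], rfl⟩
      · exact ⟨(v, u), by simp [he.symm, (hr v u he.symm).2 h], Sym2.eq_swap⟩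
  · intro e _
    rw [edgeFactor_mk, map_sub, map_X, map_X, CharTwo.sub_eq_add]

theorem coeff_ne_zero_of_map {V : Type*} {P : MvPolynomial V ℤ} {m : V →₀ ℕ}
    (h : coeff m (MvPolynomial.map (Int.castRingHom (ZMod 2)) P) ≠ 0) : coeff m P ≠ 0 := by
  intro h0
  rw [coeff_map, h0, map_zero] at h
  exact h rfl

/-! ### Boundary walks of faces -/

section Faces

variable {V : Type*} {G : SimpleGraph V}

instance finite_dart [Finite V] : Finite G.Dart :=
  Finite.of_injective (fun d : G.Dart => d.toProd) fun _ _ h => SimpleGraph.Dart.ext _ _ h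

namespace RotationSystem

variable (R : RotationSystem G)

instance finite_face [Finite V] : Finite R.Face :=
  inferInstanceAs (Finite (Quotient _))

theorem facePerm_fst (d : G.Dart) : (R.facePerm d).fst = d.snd := R.next_fst d.symm

theorem facePerm_ne (d : G.Dart) : R.facePerm d ≠ d := fun h =>
  d.adj.ne' (by rw [← R.facePerm_fst d, h])

theorem faceOf_eq_iff {d e : G.Dart} :
    R.faceOf d = R.faceOf e ↔ R.facePerm.SameCycle d e := Quotient.eq

theorem faceOf_facePerm (d : G.Dart) : R.faceOf (R.facePerm d) = R.faceOf d := by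
  rw [faceOf_eq_iff]
  exact (Equiv.Perm.SameCycle.refl _ d).apply_left

theorem onFace_fst (d : G.Dart) : R.OnFace d.fst (R.faceOf d) := ⟨d, rfl, rfl⟩

theorem onFace_snd (d : G.Dart) : R.OnFace d.snd (R.faceOf d) :=
  ⟨R.facePerm d, R.facePerm_fst d, R.faceOf_facePerm d⟩

/-- The darts on the boundary of a face. -/
def darts (f : R.Face) : Set G.Dart := {d | R.faceOf d = f}

theorem ncard_darts (f : R.Face) : (R.darts f).ncard = R.faceLength f :=
  (Nat.card_coe_set_eq _).symm

/-- Induction along the boundary walk of a face. -/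
theorem mem_of_faceOf_eq [Finite V] {s : Set G.Dart} (hs : ∀ e ∈ s, R.facePerm e ∈ s)
    {d e : G.Dart} (hd : d ∈ s) (h : R.faceOf d = R.faceOf e) : e ∈ s := by
  rw [faceOf_eq_iff] at h
  -- By finiteness the orbit is reached by forward steps alone.
  obtain ⟨n, rfl⟩ := h.exists_nat_pow_eq
  clear h
  induction n with
  | zero => exact hd
  | succ n ih =>
    rw [pow_succ', Equiv.Perm.mul_apply]
    exact hs _ ih

theorem ncard_onFace_le [Finite V] (f : R.Face) : {v | R.OnFace v f}.ncard ≤ R.faceLength f := by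
  have : {v | R.OnFace v f} = (fun d : G.Dart => d.fst) '' R.darts f := by
    ext v
    exact ⟨fun ⟨d, h1, h2⟩ => ⟨d, h2, h1⟩, fun ⟨d, h2, h1⟩ => ⟨d, h1, h2⟩⟩
  rw [this, ← ncard_darts]
  exact Set.ncard_image_le (Set.toFinite _)

theorem injOn_of_ncard_onFace [Finite V] {f : R.Face}
    (h : R.faceLength f ≤ {v | R.OnFace v f}.ncard) :
    Set.InjOn (fun d : G.Dart => d.fst) (R.darts f) := by
  have : {v | R.OnFace v f} = (fun d : G.Dart => d.fst) '' R.darts f := by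
    ext v
    exact ⟨fun ⟨d, h1, h2⟩ => ⟨d, h2, h1⟩, fun ⟨d, h2, h1⟩ => ⟨d, h1, h2⟩⟩
  rw [this, ← ncard_darts] at h
  exact Set.injOn_of_ncard_image_eq (le_antisymm (Set.ncard_image_le (Set.toFinite _)) h)
    (Set.toFinite _)

/-- If both ends of a dart of the face `f` lie in `U`, then at least two occurrences of vertices on
the boundary of `f` lie in `U`. If there are no others, then no vertex is repeated on it. -/
theorem ncard_onFace_diff [Finite V] {f : R.Face} {U : Set V} {d : G.Dart}
    (hd : R.faceOf d = f) (h1 : d.fst ∈ U) (h2 : d.snd ∈ U) :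
    ({v | R.OnFace v f} \ U).ncard + 2 ≤ R.faceLength f ∧
      (R.faceLength f ≤ ({v | R.OnFace v f} \ U).ncard + 2 →
        Set.InjOn (fun d : G.Dart => d.fst) (R.darts f) ∧
          ∀ v ∈ U, R.OnFace v f → v = d.fst ∨ v = d.snd) := by
  -- The removed darts start at the two ends of `d`, both in `U`, so vertices outside `U` must come
  -- from `A`. Equality of the counts makes `A` biject with them.
  set A : Set G.Dart := R.darts f \ {d, R.facePerm d} with hA
  have hsub : {d, R.facePerm d} ⊆ R.darts f := by
    rintro e (rfl | rfl)
    · exact hd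
    · exact (R.faceOf_facePerm d).trans hd
  have hcard : A.ncard + 2 = R.faceLength f := by
    rw [← ncard_darts, ← Set.ncard_sdiff_add_ncard_of_subset hsub (Set.toFinite _),
      Set.ncard_pair (R.facePerm_ne d).symm]
  have hpair : ∀ e ∈ ({d, R.facePerm d} : Set G.Dart), e.fst ∈ U := by
    rintro e (rfl | rfl)
    · exact h1
    · rwa [facePerm_fst]
  have himg : {v | R.OnFace v f} \ U ⊆ (fun d : G.Dart => d.fst) '' A := by
    rintro v ⟨⟨e, rfl, he⟩, hv⟩
    exact ⟨e, ⟨he, fun h => hv (hpair e h)⟩, rfl⟩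
  have hle1 := Set.ncard_le_ncard himg (Set.toFinite _)
  have hle2 : ((fun d : G.Dart => d.fst) '' A).ncard ≤ A.ncard := Set.ncard_image_le (Set.toFinite _)
  refine ⟨by omega, fun hge => ?_⟩
  have heq := Set.eq_of_subset_of_ncard_le himg (by omega) (Set.toFinite _)
  have hinj : Set.InjOn (fun d : G.Dart => d.fst) A :=
    Set.injOn_of_ncard_image_eq (by omega) (Set.toFinite _)
  have hAU : ∀ e ∈ A, e.fst ∉ U := fun e he =>
    ((heq ▸ Set.mem_image_of_mem _ he : e.fst ∈ {v | R.OnFace v f} \ U)).2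
  have hsplit : ∀ e ∈ R.darts f, e ∈ A ∨ e ∈ ({d, R.facePerm d} : Set G.Dart) := fun e he =>
    or_iff_not_imp_right.2 fun h => ⟨he, h⟩
  have hfst := R.facePerm_fst d
  have hne := d.adj.ne
  refine ⟨fun e he e' he' hee => ?_, fun v hv hvf => ?_⟩
  · dsimp only at hee
    rcases hsplit e he with h | h <;> rcases hsplit e' he' with h' | h'
    · exact hinj h h' hee
    · exact absurd (hee ▸ hpair e' h') (hAU e h)
    · exact absurd (hee ▸ hpair e h) (hAU e' h')
    · rcases h with rfl | rfl <;> rcases h' with rfl | rfl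
      · rfl
      · exact absurd (hee.trans hfst) hne
      · exact absurd (hee.symm.trans hfst) hne
      · rfl
  · obtain ⟨e, rfl, he⟩ := hvf
    rcases hsplit e he with h | rfl | rfl
    · exact absurd hv (hAU e h)
    · exact Or.inl rfl
    · exact Or.inr hfst

/-- The vertices and the edges of a triangular face. -/
theorem exists_of_faceLength_eq_three [Finite V] (d : G.Dart)
    (h : R.faceLength (R.faceOf d) = 3) :
    ∃ w, w ≠ d.fst ∧ w ≠ d.snd ∧
      (∀ v, R.OnFace v (R.faceOf d) ↔ v = d.fst ∨ v = d.snd ∨ v = w) ∧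
      ∀ e : Sym2 V, (∃ d', R.faceOf d' = R.faceOf d ∧ d'.edge = e) ↔
        e = s(d.fst, d.snd) ∨ e = s(w, d.fst) ∨ e = s(w, d.snd) := by
  set φ := R.facePerm with hφ
  have f0 := R.faceOf_facePerm d
  have f1 := R.faceOf_facePerm (φ d)
  have n1 : φ d ≠ d := R.facePerm_ne d
  have n2 : φ (φ d) ≠ φ d := R.facePerm_ne (φ d)
  have n3 : φ (φ d) ≠ d := by
    intro h3
    have hsub : R.darts (R.faceOf d) ⊆ {d, φ d} := fun e he =>
      R.mem_of_faceOf_eq (s := {d, φ d}) (by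
        rintro e (rfl | rfl)
        · exact Or.inr rfl
        · exact Or.inl h3) (Or.inl rfl) (Eq.symm he)
    have := Set.ncard_le_ncard hsub (Set.toFinite _)
    rw [ncard_darts, h, Set.ncard_pair n1.symm] at this
    omega
  have hsub : {d, φ d, φ (φ d)} ⊆ R.darts (R.faceOf d) := by
    rintro e (rfl | rfl | rfl)
    · rfl
    · exact f0
    · exact f1.trans f0
  have h3 : ({d, φ d, φ (φ d)} : Set G.Dart).ncard = 3 :=
    Set.ncard_eq_three.2 ⟨_, _, _, n1.symm, n3.symm, n2.symm, rfl⟩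
  have hdarts : R.darts (R.faceOf d) = {d, φ d, φ (φ d)} :=
    (Set.eq_of_subset_of_ncard_le hsub (by rw [ncard_darts, h, h3]) (Set.toFinite _)).symm
  have hcyc : φ (φ (φ d)) = d := by
    have hmem : φ (φ (φ d)) ∈ R.darts (R.faceOf d) :=
      (R.faceOf_facePerm _).trans (f1.trans f0)
    rw [hdarts] at hmem
    rcases hmem with h' | h' | h'
    · exact h'
    · exact absurd (φ.injective h') n3
    · exact absurd (φ.injective h') n2
  have e1 : (φ d).fst = d.snd := R.facePerm_fst d
  have e2 : (φ (φ d)).fst = (φ d).snd := R.facePerm_fst _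
  have e3 : d.fst = (φ (φ d)).snd := by
    have := R.facePerm_fst (φ (φ d))
    rwa [← hφ, hcyc] at this
  have a1 := (φ d).adj.ne
  have a2 := (φ (φ d)).adj.ne
  have hmem : ∀ d', R.faceOf d' = R.faceOf d ↔ d' = d ∨ d' = φ d ∨ d' = φ (φ d) := fun d' =>
    Set.ext_iff.1 hdarts d'
  refine ⟨(φ d).snd, ?_, ?_, fun v => ?_, fun e => ?_⟩
  · rw [← e2, e3]; exact a2
  · rw [← e1]; exact a1.symm
  · constructor
    · rintro ⟨d', rfl, hd'⟩
      rcases (hmem d').1 hd' with rfl | rfl | rfl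
      · exact Or.inl rfl
      · exact Or.inr (Or.inl e1)
      · exact Or.inr (Or.inr e2)
    · rintro (rfl | rfl | rfl)
      · exact R.onFace_fst d
      · exact R.onFace_snd d
      · exact ⟨_, e2, f1.trans f0⟩
  · have g0 : d.edge = s(d.fst, d.snd) := rfl
    have g1 : (φ d).edge = s((φ d).snd, d.snd) := by rw [← e1]; exact Sym2.eq_swap
    have g2 : (φ (φ d)).edge = s((φ d).snd, d.fst) := by rw [← e2, e3]; rfl
    constructor
    · rintro ⟨d', hd', rfl⟩
      rcases (hmem d').1 hd' with rfl | rfl | rfl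
      · exact Or.inl g0
      · exact Or.inr (Or.inr g1)
      · exact Or.inr (Or.inl g2)
    · rintro (rfl | rfl | rfl)
      · exact ⟨d, rfl, g0⟩
      · exact ⟨_, f1.trans f0, g2⟩
      · exact ⟨_, f0, g1⟩

/-- Twice the number of edges is the sum of the lengths of the faces. -/
theorem sum_faceLength [Fintype V] [Fintype R.Face] :
    ∑ f : R.Face, R.faceLength f = 2 * Nat.card G.edgeSet := by
  classical
  have h1 := G.dart_card_eq_twice_card_edges
  rw [Nat.card_eq_fintype_card, ← SimpleGraph.edgeFinset_card, ← h1]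
  rw [← Finset.card_univ, Finset.card_eq_sum_card_fiberwise (f := R.faceOf)
    (t := Finset.univ) (fun _ _ => Finset.mem_coe.2 (Finset.mem_univ _))]
  refine Finset.sum_congr rfl fun f _ => ?_
  rw [faceLength, Nat.card_eq_fintype_card, Fintype.card_subtype]

end RotationSystem

end Faces

/-! ### Chains of faces and the Euler count -/

/-- For vertex counts `u` and face lengths `l`, the hypothesis says that a new face of length `l`
brings at most `l - 2` new vertices. The inequalities telescope, so equality in the sum forces it in
every step. -/
theorem eq_of_sum_le {u l : ℕ → ℕ} {N : ℕ} (h0 : u 0 ≤ l 0)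
    (hs : ∀ j < N, u (j + 1) + 2 ≤ u j + l (j + 1)) :
    u N + 2 * N ≤ ∑ j ∈ Finset.range (N + 1), l j ∧
      (∑ j ∈ Finset.range (N + 1), l j ≤ u N + 2 * N →
        l 0 = u 0 ∧ ∀ j < N, u j + l (j + 1) = u (j + 1) + 2) := by
  induction N with
  | zero => simp; omega
  | succ N ih =>
    obtain ⟨h1, h2⟩ := ih fun j hj => hs j (by omega)
    have h3 := hs N (by omega)
    rw [Finset.sum_range_succ]
    refine ⟨by omega, fun h => ?_⟩
    obtain ⟨h4, h5⟩ := h2 (by omega)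
    refine ⟨h4, fun j hj => ?_⟩
    rcases Nat.lt_succ_iff_lt_or_eq.1 hj with hj | rfl
    · exact h5 j hj
    · omega

namespace OuterplaneEmbedding

variable {V : Type*} {G : SimpleGraph V} (R : OuterplaneEmbedding G)

/-- The sequence `f 0, …, f N` of inner faces is an induced path of the weak dual, and its faces
cover the vertices of the graph. -/
structure IsFaceChain (N : ℕ) (f : ℕ → R.InnerFace) : Prop where
  inj : ∀ i ≤ N, ∀ j ≤ N, f i = f j → i = j
  adj : ∀ j < N, R.weakDual.Adj (f j) (f (j + 1))
  not_adj : ∀ i j, i + 2 ≤ j → j ≤ N → ¬ R.weakDual.Adj (f i) (f j)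
  cover : ∀ v, ∃ j ≤ N, R.OnInner v (f j)

/-- The vertices on the first faces of a sequence, up to the `j`-th one. -/
def vertsUpTo (f : ℕ → R.InnerFace) (j : ℕ) : Set V := {v | ∃ i ≤ j, R.OnInner v (f i)}

variable {R} {N : ℕ} {f : ℕ → R.InnerFace}

theorem onInner_fst {g : R.InnerFace} {d : G.Dart} (hd : R.faceOf d = g.1) :
    R.OnInner d.fst g := ⟨d, rfl, hd⟩

theorem onInner_snd {g : R.InnerFace} {d : G.Dart} (hd : R.faceOf d = g.1) :
    R.OnInner d.snd g := ⟨R.facePerm d, R.facePerm_fst d, (R.faceOf_facePerm d).trans hd⟩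

theorem IsFaceChain.reverse (h : R.IsFaceChain N f) : R.IsFaceChain N fun j => f (N - j) where
  inj i hi j hj hij := by
    have := h.inj _ (Nat.sub_le N i) _ (Nat.sub_le N j) hij
    omega
  adj j hj := by
    have := h.adj (N - (j + 1)) (by omega)
    rw [show N - (j + 1) + 1 = N - j by omega] at this
    exact this.symm
  not_adj i j hij hj hadj := h.not_adj (N - j) (N - i) (by omega) (by omega) hadj.symm
  cover v := by
    obtain ⟨j, hj, hv⟩ := h.cover v
    exact ⟨N - j, by omega, by rwa [Nat.sub_sub_self hj]⟩

/-- A repeated face or a chord of the dual path would give a shorter walk between faces containing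
`x` and `y`. -/
theorem isFaceChain_getVert {x y : V} {g₁ g₂ : R.InnerFace} (p : R.weakDual.Walk g₁ g₂)
    (hp : R.IsShortestBetween x y p) (hcover : R.subgraphAlong p = ⊤) :
    R.IsFaceChain p.length p.getVert := by
  classical
  have hpath : p.IsPath := by
    have := p.bypass_eq_self_of_length_le_length_bypass (hp.2.2 _ _ p.bypass hp.1 hp.2.1)
    rw [← this]
    exact p.bypass_isPath
  refine ⟨fun i hi j hj hij => hpath.getVert_injOn hi hj hij,
    fun j hj => p.adj_getVert_succ hj, fun i j hij hj hadj => ?_, fun v => ?_⟩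
  · have := hp.2.2 _ _ ((p.take i).append (SimpleGraph.Walk.cons hadj (p.drop j))) hp.1 hp.2.1
    rw [SimpleGraph.Walk.length_append, SimpleGraph.Walk.length_cons,
      SimpleGraph.Walk.take_length, SimpleGraph.Walk.drop_length] at this
    omega
  · have : v ∈ (R.subgraphAlong p).verts := by rw [hcover]; trivial
    obtain ⟨g, hg, hv⟩ := this
    obtain ⟨j, rfl, hj⟩ := SimpleGraph.Walk.mem_support_iff_exists_getVert.1 hg
    exact ⟨j, hj, hv⟩

theorem vertsUpTo_succ (f : ℕ → R.InnerFace) (j : ℕ) :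
    R.vertsUpTo f (j + 1) = R.vertsUpTo f j ∪ {v | R.OnInner v (f (j + 1))} := by
  ext v
  constructor
  · rintro ⟨i, hi, hv⟩
    rcases Nat.le_succ_iff.1 hi with hi | rfl
    · exact Or.inl ⟨i, hi, hv⟩
    · exact Or.inr hv
  · rintro (⟨i, hi, hv⟩ | hv)
    · exact ⟨i, by omega, hv⟩
    · exact ⟨j + 1, le_rfl, hv⟩

theorem ncard_vertsUpTo_succ [Finite V] (f : ℕ → R.InnerFace) (j : ℕ) :
    (R.vertsUpTo f (j + 1)).ncard = (R.vertsUpTo f j).ncard +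
      ({v | R.OnFace v (f (j + 1)).1} \ R.vertsUpTo f j).ncard := by
  rw [vertsUpTo_succ, ← Set.union_sdiff_self]
  exact Set.ncard_union_eq Set.disjoint_sdiff_right (Set.toFinite _) (Set.toFinite _)

/-- Let `B` be the set of inner faces off the chain. Euler's formula gives `|E| = |V| + N + |B|`. On
the other hand `2|E|`, the sum of the face lengths, is at least `|V|` for the outer face, plus `|V|
+ 2N` for the chain, plus `3|B|`. Hence `B` is empty and every estimate is sharp. -/
theorem IsFaceChain.tight [Finite V] (h : R.IsFaceChain N f)
    (hlen : ∀ g : R.InnerFace, 3 ≤ R.faceLength g.1) :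
    (∀ g : R.InnerFace, ∃ j ≤ N, f j = g) ∧ R.faceLength R.outer ≤ Nat.card V ∧
      R.faceLength (f 0).1 = (R.vertsUpTo f 0).ncard ∧
      ∀ j < N, (R.vertsUpTo f j).ncard + R.faceLength (f (j + 1)).1 =
        (R.vertsUpTo f (j + 1)).ncard + 2 := by
  classical
  have := Fintype.ofFinite V
  have := Fintype.ofFinite R.Face
  have h0 : (R.vertsUpTo f 0).ncard ≤ R.faceLength (f 0).1 := by
    have : R.vertsUpTo f 0 = {v | R.OnFace v (f 0).1} := by
      ext v
      simp [vertsUpTo, OnInner]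
    rw [this]
    exact R.ncard_onFace_le _
  have hs : ∀ j < N, (R.vertsUpTo f (j + 1)).ncard + 2 ≤
      (R.vertsUpTo f j).ncard + R.faceLength (f (j + 1)).1 := by
    intro j hj
    obtain ⟨d, hd1, hd2⟩ := (h.adj j hj).2
    have := (R.ncard_onFace_diff (U := R.vertsUpTo f j) hd2
      ⟨j, le_rfl, onInner_snd hd1⟩ ⟨j, le_rfl, onInner_fst hd1⟩).1
    rw [ncard_vertsUpTo_succ]
    omega
  obtain ⟨hge, htight⟩ := eq_of_sum_le (u := fun j => (R.vertsUpTo f j).ncard)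
    (l := fun j => R.faceLength (f j).1) h0 hs
  have huniv : R.vertsUpTo f N = Set.univ := Set.eq_univ_of_forall h.cover
  simp only [huniv, Set.ncard_univ] at hge htight
  have houter : Nat.card V ≤ R.faceLength R.outer := by
    have h1 := R.ncard_onFace_le R.outer
    have h2 : {v | R.OnFace v R.outer} = Set.univ := Set.eq_univ_of_forall R.onFace_outer
    rwa [h2, Set.ncard_univ] at h1
  set A : Finset R.Face := (Finset.range (N + 1)).image fun j => (f j).1 with hA
  have hinj : Set.InjOn (fun j => (f j).1) (Finset.range (N + 1) : Set ℕ) := by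
    intro i hi j hj hij
    rw [Finset.coe_range, Set.mem_Iio] at hi hj
    exact h.inj i (by omega) j (by omega) (Subtype.ext hij)
  have hAcard : A.card = N + 1 := by rw [hA, Finset.card_image_of_injOn hinj, Finset.card_range]
  have hAsum : ∑ g ∈ A, R.faceLength g = ∑ j ∈ Finset.range (N + 1), R.faceLength (f j).1 :=
    Finset.sum_image hinj
  have hout : R.outer ∉ A := by
    rw [hA, Finset.mem_image]
    rintro ⟨j, _, hj⟩
    exact (f j).2 hj
  set B : Finset R.Face := (insert R.outer A)ᶜ with hB
  have hsum := R.sum_faceLength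
  rw [← Finset.sum_add_sum_compl (insert R.outer A), Finset.sum_insert hout, hAsum, ← hB]
    at hsum
  have hcard := Finset.card_add_card_compl (insert R.outer A)
  rw [Finset.card_insert_of_notMem hout, hAcard, ← Nat.card_eq_fintype_card, ← hB]
    at hcard
  have hBsum : 3 * B.card ≤ ∑ g ∈ B, R.faceLength g := by
    rw [mul_comm, ← smul_eq_mul, ← Finset.sum_const]
    refine Finset.sum_le_sum fun g hg => ?_
    rw [hB, Finset.mem_compl, Finset.mem_insert, not_or] at hg
    exact hlen ⟨g, hg.1⟩
  have heuler := R.euler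
  have hB0 : B.card = 0 := by omega
  refine ⟨fun g => ?_, by omega, htight (by omega)⟩
  have hg : g.1 ∉ B := by rw [Finset.card_eq_zero.1 hB0]; exact Finset.notMem_empty _
  rw [hB, Finset.mem_compl, not_not, Finset.mem_insert, hA, Finset.mem_image] at hg
  rcases hg with hg | ⟨j, hj, hg⟩
  · exact absurd hg g.2
  · exact ⟨j, Nat.lt_succ_iff.1 (Finset.mem_range.1 hj), Subtype.ext hg⟩

/-- Sharpness of the count leaves no boundary occurrence of an old vertex besides the two ends of
the shared edge. -/
theorem IsFaceChain.eq_or_eq [Finite V] (h : R.IsFaceChain N f)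
    (hlen : ∀ g : R.InnerFace, 3 ≤ R.faceLength g.1) {j : ℕ} (hj : j < N) {d : G.Dart}
    (hd : R.faceOf d = (f j).1) (hd' : R.faceOf d.symm = (f (j + 1)).1) :
    Set.InjOn (fun d : G.Dart => d.fst) (R.darts (f (j + 1)).1) ∧
      ∀ v ∈ R.vertsUpTo f j, R.OnInner v (f (j + 1)) → v = d.fst ∨ v = d.snd := by
  have htight := (h.tight hlen).2.2.2 j hj
  rw [ncard_vertsUpTo_succ] at htight
  have := (R.ncard_onFace_diff (U := R.vertsUpTo f j) hd'
    ⟨j, le_rfl, onInner_snd hd⟩ ⟨j, le_rfl, onInner_fst hd⟩).2 (by omega)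
  exact ⟨this.1, fun v hv hvf => (this.2 v hv hvf).symm⟩

/-- No vertex is repeated on the boundary of an inner face. -/
theorem IsFaceChain.injOn_fst [Finite V] (h : R.IsFaceChain N f)
    (hlen : ∀ g : R.InnerFace, 3 ≤ R.faceLength g.1) {j : ℕ} (hj : j ≤ N) :
    Set.InjOn (fun d : G.Dart => d.fst) (R.darts (f j).1) := by
  rcases j with _ | j
  · refine R.injOn_of_ncard_onFace ?_
    rw [(h.tight hlen).2.2.1]
    refine Set.ncard_le_ncard ?_ (Set.toFinite _)
    rintro v ⟨i, hi, hv⟩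
    rwa [Nat.le_zero.1 hi] at hv
  · obtain ⟨d, hd, hd'⟩ := (h.adj j hj).2
    exact (h.eq_or_eq hlen hj hd hd').1

/-- Every edge lies on an inner face. -/
theorem IsFaceChain.exists_faceOf [Finite V] (h : R.IsFaceChain N f)
    (hlen : ∀ g : R.InnerFace, 3 ≤ R.faceLength g.1) (hV : 3 ≤ Nat.card V) (d : G.Dart) :
    ∃ j ≤ N, ∃ d', R.faceOf d' = (f j).1 ∧ d'.edge = d.edge := by
  -- The outer walk has length at most `|V|`, so it repeats no vertex. With both sides of the edge
  -- outer, it would close up after `d` and `d.symm`, leaving only two vertices.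
  have key : R.faceOf d ≠ R.outer ∨ R.faceOf d.symm ≠ R.outer := by
    by_contra! hcon
    have hcover : {v | R.OnFace v R.outer} = Set.univ := Set.eq_univ_of_forall R.onFace_outer
    have hinj := R.injOn_of_ncard_onFace (f := R.outer) (by
      rw [hcover, Set.ncard_univ]
      exact (h.tight hlen).2.1)
    have h1 : R.facePerm d = d.symm :=
      hinj ((R.faceOf_facePerm d).trans hcon.1) hcon.2 (R.facePerm_fst d)
    have h2 : R.facePerm d.symm = d :=
      hinj ((R.faceOf_facePerm _).trans hcon.2) hcon.1 (R.facePerm_fst d.symm)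
    have hsub : (Set.univ : Set V) ⊆ {d.fst, d.snd} := by
      intro v _
      obtain ⟨e, rfl, he⟩ := R.onFace_outer v
      have : e ∈ ({d, d.symm} : Set G.Dart) := by
        refine R.mem_of_faceOf_eq ?_ (Or.inl rfl) (hcon.1.trans he.symm)
        rintro e (rfl | rfl)
        · exact Or.inr h1
        · exact Or.inl h2
      rcases this with rfl | rfl
      · exact Or.inl rfl
      · exact Or.inr rfl
    have hcard := Set.ncard_le_ncard hsub (Set.toFinite _)
    rw [Set.ncard_univ, Set.ncard_pair d.adj.ne] at hcard
    omega
  rcases key with hd | hd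
  · obtain ⟨j, hj, hfj⟩ := (h.tight hlen).1 ⟨_, hd⟩
    exact ⟨j, hj, d, by rw [hfj], rfl⟩
  · obtain ⟨j, hj, hfj⟩ := (h.tight hlen).1 ⟨_, hd⟩
    exact ⟨j, hj, d.symm, by rw [hfj], d.edge_symm⟩

/-- The edges on the first faces of a sequence, up to the `j`-th one. -/
def edgesUpTo (R : OuterplaneEmbedding G) (f : ℕ → R.InnerFace) (j : ℕ) : Set (Sym2 V) :=
  {e | ∃ i ≤ j, ∃ d, R.faceOf d = (f i).1 ∧ d.edge = e}

/-- The triangles at the beginning of a chain of faces form a two-tree. -/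
theorem IsFaceChain.isTwoTree [Finite V] [DecidableEq V] (h : R.IsFaceChain N f)
    (hlen : ∀ g : R.InnerFace, 3 ≤ R.faceLength g.1) {j : ℕ} (hj : j ≤ N)
    (htri : ∀ i ≤ j, R.IsTriangular (f i)) :
    IsTwoTree (Set.toFinite (R.vertsUpTo f j)).toFinset
      (Set.toFinite (R.edgesUpTo f j)).toFinset := by
  induction j with
  | zero =>
    obtain ⟨d, hd⟩ := Quotient.exists_rep (f 0).1
    change R.faceOf d = _ at hd
    obtain ⟨w, hw1, hw2, hv, he⟩ := R.exists_of_faceLength_eq_three d (by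
      rw [hd]; exact htri 0 le_rfl)
    rw [hd] at hv he
    convert IsTwoTree.attach _ _ d.fst d.snd w (IsTwoTree.edge d.fst d.snd d.adj.ne)
      (Finset.mem_singleton_self _) (by simp [hw1, hw2]) using 1
    · ext v
      simp only [Set.Finite.mem_toFinset, vertsUpTo, Set.mem_ofPred_eq, Nat.le_zero,
        exists_eq_left, Finset.mem_insert, Finset.mem_singleton]
      rw [OnInner, hv]
      tauto
    · ext e
      simp only [Set.Finite.mem_toFinset, edgesUpTo, Set.mem_ofPred_eq, Nat.le_zero,
        exists_eq_left, Finset.mem_insert, Finset.mem_singleton]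
      rw [he]
      tauto
  | succ j ih =>
    obtain ⟨d, hd, hd'⟩ := (h.adj j hj).2
    obtain ⟨w, hw1, hw2, hv, he⟩ := R.exists_of_faceLength_eq_three d.symm (by
      rw [hd']; exact htri (j + 1) le_rfl)
    rw [hd'] at hv he
    change w ≠ d.snd at hw1
    change w ≠ d.fst at hw2
    change ∀ v, _ ↔ v = d.snd ∨ v = d.fst ∨ v = w at hv
    change ∀ e, _ ↔ e = s(d.snd, d.fst) ∨ e = s(w, d.snd) ∨ e = s(w, d.fst) at he
    have hdm : s(d.fst, d.snd) ∈ R.edgesUpTo f j := ⟨j, le_rfl, d, hd, rfl⟩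
    have hw : w ∉ R.vertsUpTo f j := fun hmem => by
      rcases (h.eq_or_eq hlen hj hd hd').2 w hmem ((hv w).2 (Or.inr (Or.inr rfl))) with h' | h'
      · exact hw2 h'
      · exact hw1 h'
    convert IsTwoTree.attach _ _ d.fst d.snd w
      (ih (by omega) fun i hi => htri i (by omega)) (by simpa using hdm) (by simpa using hw) using 1
    · ext v
      have hfst : d.fst ∈ R.vertsUpTo f j := ⟨j, le_rfl, onInner_fst hd⟩
      have hsnd : d.snd ∈ R.vertsUpTo f j := ⟨j, le_rfl, onInner_snd hd⟩
      simp only [Set.Finite.mem_toFinset, vertsUpTo_succ, Finset.mem_insert, Set.mem_union,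
        Set.mem_ofPred_eq]
      rw [OnInner, hv]
      constructor
      · rintro (h' | rfl | rfl | rfl)
        exacts [Or.inr h', Or.inr hsnd, Or.inr hfst, Or.inl rfl]
      · rintro (rfl | h')
        exacts [Or.inr (Or.inr (Or.inr rfl)), Or.inl h']
    · ext e
      simp only [Set.Finite.mem_toFinset, Finset.mem_insert]
      constructor
      · rintro ⟨i, hi, hed⟩
        rcases Nat.le_succ_iff.1 hi with hi | rfl
        · exact Or.inr (Or.inr ⟨i, hi, hed⟩)
        · rcases (he e).1 hed with rfl | rfl | rfl
          · rw [Sym2.eq_swap]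
            exact Or.inr (Or.inr hdm)
          · exact Or.inr (Or.inl rfl)
          · exact Or.inl rfl
      · rintro (rfl | rfl | ⟨i, hi, hed⟩)
        · exact ⟨j + 1, le_rfl, (he _).2 (Or.inr (Or.inr rfl))⟩
        · exact ⟨j + 1, le_rfl, (he _).2 (Or.inr (Or.inl rfl))⟩
        · exact ⟨i, by omega, hed⟩

end OuterplaneEmbedding

/-! ### Shared edges and triangles in a chain -/

namespace OuterplaneEmbedding

variable {V : Type*} {G : SimpleGraph V} {R : OuterplaneEmbedding G} {N : ℕ} {f : ℕ → R.InnerFace}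

/-- A face of a chain meets its predecessors exactly in the vertices of the edge that it shares
with the last one of them. -/
theorem IsFaceChain.exists_shared [Finite V] (h : R.IsFaceChain N f)
    (hlen : ∀ g : R.InnerFace, 3 ≤ R.faceLength g.1) {j : ℕ} (hj : j < N) {a b : V} (hab : a ≠ b)
    (ha : R.OnInner a (f j)) (ha' : R.OnInner a (f (j + 1))) (hb : R.OnInner b (f j))
    (hb' : R.OnInner b (f (j + 1))) :
    (∃ d, R.faceOf d = (f (j + 1)).1 ∧ d.edge = s(a, b)) ∧
      (∃ d, R.faceOf d = (f j).1 ∧ d.edge = s(a, b)) ∧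
      ∀ v ∈ R.vertsUpTo f j, R.OnInner v (f (j + 1)) → v = a ∨ v = b := by
  obtain ⟨d, hd, hd'⟩ := (h.adj j hj).2
  have key := (h.eq_or_eq hlen hj hd hd').2
  have hedge : d.edge = s(a, b) := by
    change s(d.fst, d.snd) = _
    rcases key a ⟨j, le_rfl, ha⟩ ha' with rfl | rfl <;>
      rcases key b ⟨j, le_rfl, hb⟩ hb' with rfl | rfl
    · exact absurd rfl hab
    · rfl
    · exact Sym2.eq_swap
    · exact absurd rfl hab
  refine ⟨⟨d.symm, hd', by rw [SimpleGraph.Dart.edge_symm, hedge]⟩, ⟨d, hd, hedge⟩,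
    fun v hv hvf => ?_⟩
  rw [← Sym2.mem_iff, ← hedge]
  exact Sym2.mem_iff.2 (key v hv hvf)

/-- The faces of a chain that contain a given vertex are consecutive. -/
theorem IsFaceChain.onInner_of_le [Finite V] (h : R.IsFaceChain N f)
    (hlen : ∀ g : R.InnerFace, 3 ≤ R.faceLength g.1) {i k : ℕ} {v : V}
    (hv : v ∈ R.vertsUpTo f i) (hk : k ≤ N) (hvk : R.OnInner v (f k)) (hik : i ≤ k) :
    R.OnInner v (f i) := by
  induction k with
  | zero => rwa [Nat.le_zero.1 hik]
  | succ k ih =>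
    rcases Nat.le_succ_iff.1 hik with hik | rfl
    · refine ih (by omega) ?_ hik
      obtain ⟨d, hd, hd'⟩ := (h.adj k hk).2
      obtain ⟨l, hl, hvl⟩ := hv
      rcases (h.eq_or_eq hlen hk hd hd').2 v ⟨l, by omega, hvl⟩ hvk with rfl | rfl
      · exact onInner_fst hd
      · exact onInner_snd hd
    · exact hvk

/-- If three vertices of a face are joined pairwise by edges of the face, then the face is a
triangle. -/
theorem isTriangular_of_edges [Finite V] {F : R.InnerFace}
    (hinj : Set.InjOn (fun d : G.Dart => d.fst) (R.darts F.1)) {a b c : V}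
    (hbc : b ≠ c) {d₁ d₂ d₃ : G.Dart}
    (h₁ : R.faceOf d₁ = F.1) (h₂ : R.faceOf d₂ = F.1) (h₃ : R.faceOf d₃ = F.1)
    (e₁ : d₁.edge = s(a, b)) (e₂ : d₂.edge = s(a, c)) (e₃ : d₃.edge = s(b, c)) :
    R.IsTriangular F := by
  have hφ : ∀ d e : G.Dart, R.faceOf d = F.1 → R.faceOf e = F.1 → d.snd = e.fst →
      R.facePerm d = e := fun d e hd he hde =>
    hinj ((R.faceOf_facePerm d).trans hd) he ((R.facePerm_fst d).trans hde)
  have htri : ∀ d e g : G.Dart, R.faceOf d = F.1 → R.faceOf e = F.1 → R.faceOf g = F.1 →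
      d.snd = e.fst → e.snd = g.fst → g.snd = d.fst → R.IsTriangular F := by
    intro d e g hd he hg h1 h2 h3
    have p1 := hφ d e hd he h1
    have p2 := hφ e g he hg h2
    have p3 := hφ g d hg hd h3
    have hdarts : R.darts F.1 = {d, e, g} := by
      ext d'
      constructor
      · intro hd'
        refine R.mem_of_faceOf_eq ?_ (Or.inl rfl) (hd.trans (Eq.symm hd'))
        rintro _ (rfl | rfl | rfl)
        · exact Or.inr (Or.inl p1)
        · exact Or.inr (Or.inr p2)
        · exact Or.inl p3
      · rintro (rfl | rfl | rfl) <;> assumption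
    have n1 : d ≠ e := fun h => by subst h; exact R.facePerm_ne _ p1
    have n2 : e ≠ g := fun h => by subst h; exact R.facePerm_ne _ p2
    have n3 : d ≠ g := fun h => by subst h; exact R.facePerm_ne _ p3
    rw [IsTriangular, ← R.ncard_darts, hdarts]
    exact Set.ncard_eq_three.2 ⟨d, e, g, n1, n3, n2, rfl⟩
  have same : ∀ d e : G.Dart, R.faceOf d = F.1 → R.faceOf e = F.1 → d.fst = e.fst → d = e :=
    fun d e hd he hde => hinj hd he hde
  have u₁ := Sym2.eq_iff.1 (show s(d₁.fst, d₁.snd) = s(a, b) from e₁)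
  have u₂ := Sym2.eq_iff.1 (show s(d₂.fst, d₂.snd) = s(a, c) from e₂)
  have u₃ := Sym2.eq_iff.1 (show s(d₃.fst, d₃.snd) = s(b, c) from e₃)
  have end_inj : ∀ d e : G.Dart, R.faceOf d = F.1 → R.faceOf e = F.1 → d.snd = e.snd → d = e :=
    fun d e hd he hde => R.facePerm.injective
      (hinj ((R.faceOf_facePerm d).trans hd) ((R.faceOf_facePerm e).trans he)
        ((R.facePerm_fst d).trans (hde.trans (R.facePerm_fst e).symm)))
  have n12 : d₁ ≠ d₂ := fun h => hbc (by
    have := e₁.symm.trans (h ▸ e₂)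
    exact Sym2.congr_right.1 this)
  -- No two darts of the face share an initial or a final vertex, so of the eight orientations only
  -- the two cyclic ones survive.
  rcases u₁ with ⟨q1, q2⟩ | ⟨q1, q2⟩ <;> rcases u₂ with ⟨q3, q4⟩ | ⟨q3, q4⟩
  · exact absurd (same d₁ d₂ h₁ h₂ (q1.trans q3.symm)) n12
  · rcases u₃ with ⟨q5, q6⟩ | ⟨q5, q6⟩
    · exact htri d₁ d₃ d₂ h₁ h₃ h₂ (q2.trans q5.symm) (q6.trans q3.symm) (q4.trans q1.symm)
    · have := same d₃ d₂ h₃ h₂ (q5.trans q3.symm)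
      exact absurd (by rw [q1, q2, ← q4, ← this, q6]) d₁.adj.ne
  · rcases u₃ with ⟨q5, q6⟩ | ⟨q5, q6⟩
    · have := end_inj d₃ d₂ h₃ h₂ (q6.trans q4.symm)
      exact absurd (by rw [q1, ← q5, this, q3, ← q2]) d₁.adj.ne
    · exact htri d₂ d₃ d₁ h₂ h₃ h₁ (q4.trans q5.symm) (q6.trans q1.symm) (q2.trans q3.symm)
  · exact absurd (end_inj d₁ d₂ h₁ h₂ (q2.trans q4.symm)) n12

end OuterplaneEmbedding

/-! ### Assembling the monomial from the two sides of the exceptional face -/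

namespace OuterplaneEmbedding

variable {V : Type*} {G : SimpleGraph V} {R : OuterplaneEmbedding G}

set_option maxHeartbeats 400000 in
open Classical in
/-- Exponents of monomials of the graph polynomial of a chain of faces in which all the faces
except for one are triangles. -/
theorem IsFaceChain.hasMonomial [Fintype V] {k m : ℕ} {f : ℕ → R.InnerFace}
    (h : R.IsFaceChain (k + 2 + m) f) (hlen : ∀ g : R.InnerFace, 3 ≤ R.faceLength g.1)
    (hV : 3 ≤ Nat.card V) (htri : ∀ j ≤ k + 2 + m, j ≠ k + 1 → R.IsTriangular (f j))
    (hF : ¬ R.IsTriangular (f (k + 1))) {r : V → V → Prop} (hr : IsOrientation G r)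
    {a b c x y : V} (hab : a ≠ b) (hac : a ≠ c) (hbc : b ≠ c)
    (haF : R.OnInner a (f (k + 1))) (hbF : R.OnInner b (f (k + 1)))
    (hcF : R.OnInner c (f (k + 1))) (ha₁ : R.OnInner a (f k)) (hb₁ : R.OnInner b (f k))
    (ha₂ : R.OnInner a (f (k + 2))) (hc₂ : R.OnInner c (f (k + 2)))
    (hx : R.OnInner x (f 0)) (hy : R.OnInner y (f (k + 2 + m)))
    (hxF : ¬ R.OnInner x (f (k + 1))) (hyF : ¬ R.OnInner y (f (k + 1)))
    {C : V → ZMod 3} (hC : ∀ u v, G.Adj u v → u ∈ R.remaining (f (k + 1)) a b c →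
      v ∈ R.remaining (f (k + 1)) a b c → C u ≠ C v)
    {x₁ a₁ b₁ y₂ a₂ c₂ : ℕ} (hx₁ : x₁ ≤ 2) (ha₁' : a₁ ≤ 2) (hb₁' : b₁ ≤ 2) (hy₂ : y₂ ≤ 2)
    (ha₂' : a₂ ≤ 2) (hc₂' : c₂ ≤ 2) (hs₁ : x₁ + a₁ + b₁ = 3) (hs₂ : y₂ + a₂ + c₂ = 3)
    (hCs₁ : (x₁ * C x + a₁ * C a + b₁ * C b : ZMod 3) ≠ 0)
    (hCs₂ : (y₂ * C y + a₂ * C a + c₂ * C c : ZMod 3) ≠ 0) (ha : 2 ≤ a₁ + a₂) :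
    HasMonomial (graphPolynomial G r) x y (2 - x₁) (2 - y₂) := by
  set F := f (k + 1) with hFdef
  -- The chain read from the end of `y`: indices `0` to `m` run through the triangles beyond `F`,
  -- and `m + 1` is `F`.
  set g : ℕ → R.InnerFace := fun j => f (k + 2 + m - j) with hg
  have h' : R.IsFaceChain (k + 2 + m) g := h.reverse
  have hgm : g m = f (k + 2) := by simp only [hg, Nat.add_sub_cancel]
  have hgm' : g (m + 1) = F := by
    simp only [hg, hFdef]
    congr 1
    omega
  have hinjF : Set.InjOn (fun d : G.Dart => d.fst) (R.darts F.1) :=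
    h.injOn_fst hlen (j := k + 1) (by omega)
  obtain ⟨⟨d₁, hd₁, he₁⟩, ⟨d₁', hd₁', he₁'⟩, hS₁⟩ :=
    h.exists_shared hlen (j := k) (by omega) hab ha₁ haF hb₁ hbF
  obtain ⟨⟨d₂, hd₂, he₂⟩, ⟨d₂', hd₂', he₂'⟩, hS₂⟩ :=
    h'.exists_shared hlen (j := m) (by omega) hac (by rwa [hgm]) (by rwa [hgm'])
      (by rwa [hgm]) (by rwa [hgm'])
  rw [hgm'] at hd₂ hS₂
  set W₁ := R.vertsUpTo f k with hW₁
  set W₂ := R.vertsUpTo g m with hW₂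
  have mem₂ : ∀ {v l}, k + 2 ≤ l → l ≤ k + 2 + m → R.OnInner v (f l) → v ∈ W₂ := by
    intro v l hl hl' hv
    refine ⟨k + 2 + m - l, by omega, ?_⟩
    simp only [hg]
    rwa [Nat.sub_sub_self hl']
  have hxW : x ∈ W₁ := ⟨0, Nat.zero_le _, hx⟩
  have haW₁ : a ∈ W₁ := ⟨k, le_rfl, ha₁⟩
  have hbW : b ∈ W₁ := ⟨k, le_rfl, hb₁⟩
  have hyW : y ∈ W₂ := mem₂ (by omega) le_rfl hy
  have haW₂ : a ∈ W₂ := mem₂ le_rfl (by omega) ha₂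
  have hcW : c ∈ W₂ := mem₂ le_rfl (by omega) hc₂
  -- A vertex on both sides also lies on `F`, hence in both `{a, b}` and `{a, c}`.
  have hinter : ∀ v, v ∈ W₁ → v ∈ W₂ → v = a := by
    rintro v hv₁ hv₂
    have hvF : R.OnInner v F := by
      obtain ⟨l, hl, hvl⟩ := hv₂
      obtain ⟨l', hl', hvl'⟩ := hv₁
      exact h.onInner_of_le hlen ⟨l', by omega, hvl'⟩ (by omega) hvl (by omega)
    rcases hS₁ v hv₁ hvF with rfl | rfl
    · rfl
    · rcases hS₂ v hv₂ hvF with h | h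
      · exact h
      · exact absurd h hbc
  have hxa : x ≠ a := fun h => hxF (h ▸ haF)
  have hxb : x ≠ b := fun h => hxF (h ▸ hbF)
  have hya : y ≠ a := fun h => hyF (h ▸ haF)
  have hyc : y ≠ c := fun h => hyF (h ▸ hcF)
  have hxW₂ : x ∉ W₂ := fun h => hxa (hinter x hxW h)
  have hyW₁ : y ∉ W₁ := fun h => hya (hinter y h hyW)
  have hbW₂ : b ∉ W₂ := fun h => hab.symm (hinter b hbW h)
  have hcW₁ : c ∉ W₁ := fun h => hac.symm (hinter c h hcW)
  set S : Finset V := Finset.univ.filter fun v => R.OnInner v F ∧ v ≠ a ∧ v ≠ b ∧ v ≠ c with hS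
  have memS : ∀ {v}, v ∈ S ↔ R.OnInner v F ∧ v ≠ a ∧ v ≠ b ∧ v ≠ c := by simp [hS]
  have hWS₁ : ∀ {v}, v ∈ W₁ → v ∉ S := fun {v} hv hvS => by
    rw [memS] at hvS
    rcases hS₁ v hv hvS.1 with h | h
    · exact hvS.2.1 h
    · exact hvS.2.2.1 h
  have hWS₂ : ∀ {v}, v ∈ W₂ → v ∉ S := fun {v} hv hvS => by
    rw [memS] at hvS
    rcases hS₂ v hv hvS.1 with h | h
    · exact hvS.2.1 h
    · exact hvS.2.2.2 h
  have hrem : ∀ {v}, v ∉ S → v ∈ R.remaining F a b c := by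
    intro v hv hvF
    by_contra! hcon
    exact hv (memS.2 ⟨hvF, hcon⟩)
  have T₁ := h.isTwoTree hlen (j := k) (by omega) fun i hi => htri i (by omega) (by omega)
  have T₂ := h'.isTwoTree hlen (j := m) (by omega) fun i hi => htri _ (by omega) (by omega)
  set E₁ := (Set.toFinite (R.edgesUpTo f k)).toFinset with hE₁
  set E₂ := (Set.toFinite (R.edgesUpTo g m)).toFinset with hE₂
  have hG₁ : ∀ e ∈ E₁, e ∈ G.edgeFinset := by
    intro e he
    rw [hE₁, Set.Finite.mem_toFinset] at he
    obtain ⟨_, _, d, _, rfl⟩ := he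
    exact SimpleGraph.mem_edgeFinset.2 d.edge_mem
  have hG₂ : ∀ e ∈ E₂, e ∈ G.edgeFinset := by
    intro e he
    rw [hE₂, Set.Finite.mem_toFinset] at he
    obtain ⟨_, _, d, _, rfl⟩ := he
    exact SimpleGraph.mem_edgeFinset.2 d.edge_mem
  have hv₁ : ∀ e ∈ E₁, ∀ v ∈ e, v ∈ W₁ := fun e he v hv => by
    simpa using T₁.mem_of_mem he hv
  have hv₂ : ∀ e ∈ E₂, ∀ v ∈ e, v ∈ W₂ := fun e he v hv => by
    simpa using T₂.mem_of_mem he hv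
  have hdiag : ∀ e ∈ G.edgeFinset, ¬ e.IsDiag := fun e he =>
    G.not_isDiag_of_mem_edgeSet (SimpleGraph.mem_edgeFinset.1 he)
  have hface : ∀ e ∈ G.edgeFinset, e ∈ E₁ ∨ e ∈ E₂ ∨ ∃ d, R.faceOf d = F.1 ∧ d.edge = e := by
    intro e he
    induction e with
    | h u v =>
      rw [SimpleGraph.mem_edgeFinset, SimpleGraph.mem_edgeSet] at he
      obtain ⟨j, hj, d, hd, hde⟩ := h.exists_faceOf hlen hV ⟨(u, v), he⟩
      change d.edge = s(u, v) at hde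
      rw [hE₁, Set.Finite.mem_toFinset, hE₂, Set.Finite.mem_toFinset]
      rcases lt_trichotomy j (k + 1) with hjk | rfl | hjk
      · exact Or.inl ⟨j, by omega, d, hd, hde⟩
      · exact Or.inr (Or.inr ⟨d, hd, hde⟩)
      · refine Or.inr (Or.inl ⟨k + 2 + m - j, by omega, d, ?_, hde⟩)
        simp only [hg]
        rwa [Nat.sub_sub_self hj]
  -- An edge of `F` that survives joins two of `a`, `b`, `c`. The edges at `a` belong to the
  -- neighbouring triangles, and `bc` would make `F` a triangle.
  have hunion : (G.edgeFinset.filter fun e => ∀ v ∈ S, v ∉ e) = E₁ ∪ E₂ := by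
    ext e
    rw [Finset.mem_filter, Finset.mem_union]
    constructor
    · rintro ⟨he, heS⟩
      rcases hface e he with h1 | h1 | ⟨d, hd, rfl⟩
      · exact Or.inl h1
      · exact Or.inr h1
      · have hab' : s(a, b) ∈ E₁ := by
          rw [hE₁, Set.Finite.mem_toFinset]
          exact ⟨k, le_rfl, d₁', hd₁', he₁'⟩
        have hac' : s(a, c) ∈ E₂ := by
          rw [hE₂, Set.Finite.mem_toFinset]
          exact ⟨m, le_rfl, d₂', hd₂', he₂'⟩
        have hbc' : d.edge ≠ s(b, c) := fun hedge =>
          hF (isTriangular_of_edges hinjF hbc hd₁ hd₂ hd he₁ he₂ hedge)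
        have hne := d.adj.ne
        have q1 := hrem (fun hd' => heS d.fst hd' (Sym2.mem_mk_left _ _)) (onInner_fst hd)
        have q2 := hrem (fun hd' => heS d.snd hd' (Sym2.mem_mk_right _ _)) (onInner_snd hd)
        have hedge : d.edge = s(d.fst, d.snd) := rfl
        rw [hedge] at hbc' ⊢
        rcases q1 with q1 | q1 | q1 <;> rcases q2 with q2 | q2 | q2 <;>
          rw [q1, q2] at hbc' hne ⊢
        · exact absurd rfl hne
        · exact Or.inl hab'
        · exact Or.inr hac'
        · rw [Sym2.eq_swap]
          exact Or.inl hab'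
        · exact absurd rfl hne
        · exact absurd rfl hbc'
        · rw [Sym2.eq_swap]
          exact Or.inr hac'
        · exact absurd Sym2.eq_swap hbc'
        · exact absurd rfl hne
    · rintro (he | he)
      · exact ⟨hG₁ e he, fun v hv hve => hWS₁ (hv₁ e he v hve) hv⟩
      · exact ⟨hG₂ e he, fun v hv hve => hWS₂ (hv₂ e he v hve) hv⟩
  have hdisj : Disjoint E₁ E₂ := by
    rw [Finset.disjoint_left]
    intro e he he'
    refine hdiag e (hG₁ e he) ?_
    induction e with
    | h u v =>
      rw [Sym2.mk_isDiag_iff,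
        hinter u (hv₁ _ he u (Sym2.mem_mk_left u v)) (hv₂ _ he' u (Sym2.mem_mk_left u v)),
        hinter v (hv₁ _ he v (Sym2.mem_mk_right u v)) (hv₂ _ he' v (Sym2.mem_mk_right u v))]
  -- Such a vertex lies on no other inner face, so its only edges are those entering and leaving it
  -- along `F`.
  have hdeg : ∀ v ∈ S, (G.edgeFinset.filter (v ∈ ·)).card ≤ 2 := by
    intro v hv
    obtain ⟨d, hdv, hd⟩ := (memS.1 hv).1
    refine (Finset.card_le_card (t := {d.edge, (R.facePerm.symm d).edge}) ?_).trans
      Finset.card_le_two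
    intro e he
    rw [Finset.mem_filter] at he
    rw [Finset.mem_insert, Finset.mem_singleton]
    rcases hface e he.1 with h1 | h1 | ⟨d', hd', rfl⟩
    · exact absurd hv (hWS₁ (hv₁ e h1 v he.2))
    · exact absurd hv (hWS₂ (hv₂ e h1 v he.2))
    · rcases Sym2.mem_iff.1 he.2 with h1 | h1
      · left
        rw [show d' = d from hinjF hd' hd (h1.symm.trans hdv.symm)]
      · right
        have : R.facePerm d' = d := hinjF ((R.faceOf_facePerm d').trans hd') hd
          ((R.facePerm_fst d').trans (h1.symm.trans hdv.symm))
        rw [← this, Equiv.symm_apply_apply]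
  have hcol : ∀ E : Finset (Sym2 V), E ⊆ (G.edgeFinset.filter fun e => ∀ v ∈ S, v ∉ e) →
      ∀ p q, s(p, q) ∈ E → C p ≠ C q := by
    intro E hE p q hpq
    have := Finset.mem_filter.1 (hE hpq)
    exact hC p q (SimpleGraph.mem_edgeFinset.1 this.1)
      (hrem fun hp => this.2 p hp (Sym2.mem_mk_left p q))
      (hrem fun hq => this.2 q hq (Sym2.mem_mk_right p q))
  have single_le : ∀ {W : Finset V} {u v w : V} {i j l : ℕ}, u ≠ v → u ≠ w → v ≠ w →
      i ≤ 2 → j ≤ 2 → l ≤ 2 → u ∈ W → v ∈ W → w ∈ W →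
      Finsupp.single u i + Finsupp.single v j + Finsupp.single w l ≤ squares W := by
    intro W u v w i j l huv huw hvw hi hj hl hu hv hw t
    rw [squares_apply]
    by_cases h1 : t = u
    · subst h1; simpa [huv, huw, hu] using hi
    · by_cases h2 : t = v
      · subst h2; simpa [huv.symm, hvw, hv] using hj
      · by_cases h3 : t = w
        · subst h3; simpa [huw.symm, hvw.symm, hw] using hl
        · simp [h1, h2, h3]
  set D₁ : V →₀ ℕ := Finsupp.single x x₁ + Finsupp.single a a₁ + Finsupp.single b b₁ with hD₁
  set D₂ : V →₀ ℕ := Finsupp.single y y₂ + Finsupp.single a a₂ + Finsupp.single c c₂ with hD₂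
  set Q₁ := squares (Set.toFinite W₁).toFinset with hQ₁
  set Q₂ := squares (Set.toFinite W₂).toFinset with hQ₂
  have hle₁ : D₁ ≤ Q₁ := single_le hxa hxb hab hx₁ ha₁' hb₁'
    (by simpa using hxW) (by simpa using haW₁) (by simpa using hbW)
  have hle₂ : D₂ ≤ Q₂ := single_le hya hyc hac hy₂ ha₂' hc₂'
    (by simpa using hyW) (by simpa using haW₂) (by simpa using hcW)
  have hne₁ : coeff (Q₁ - D₁) (edgePoly E₁) ≠ 0 := by
    rw [T₁.coeff_edgePoly (hcol E₁ (hunion ▸ Finset.subset_union_left))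
      (tsub_add_cancel_of_le hle₁) (by simp [hD₁, hs₁])]
    simp [hD₁, colourSum_single, indicatorNe, hCs₁]
  have hne₂ : coeff (Q₂ - D₂) (edgePoly E₂) ≠ 0 := by
    rw [T₂.coeff_edgePoly (hcol E₂ (hunion ▸ Finset.subset_union_right))
      (tsub_add_cancel_of_le hle₂) (by simp [hD₂, hs₂])]
    simp [hD₂, colourSum_single, indicatorNe, hCs₂]
  have hglue := coeff_edgePoly_mul E₁ E₂ a (fun v hva ⟨e, he, hve⟩ ⟨e', he', hve'⟩ =>
    hva (hinter v (hv₁ e he v hve) (hv₂ e' he' v hve'))) _ _ hne₁ hne₂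
  have hprod : edgePoly E₁ * edgePoly E₂ =
      edgePoly (G.edgeFinset.filter fun e => ∀ v ∈ S, v ∉ e) := by
    rw [hunion]
    exact (Finset.prod_union hdisj).symm
  rw [hprod] at hglue
  have hQ₁v : ∀ v, Q₁ v = if v ∈ W₁ then 2 else 0 := fun v => by simp [hQ₁, squares_apply]
  have hQ₂v : ∀ v, Q₂ v = if v ∈ W₂ then 2 else 0 := fun v => by simp [hQ₂, squares_apply]
  obtain ⟨M, hM, hMout, hMS⟩ := exists_coeff_edgePoly_ne_zero G.edgeFinset hdiag S hdeg
    (Q₁ - D₁ + (Q₂ - D₂)) (fun v hv => by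
      have n1 : v ∉ W₁ := fun h => hWS₁ h hv
      have n2 : v ∉ W₂ := fun h => hWS₂ h hv
      simp [hQ₁v, hQ₂v, n1, n2]) (by convert hglue)
  rw [← map_graphPolynomial G hr] at hM
  refine ⟨M, coeff_ne_zero_of_map hM, ?_, ?_, fun v hvx hvy => ?_⟩
  · rw [hMout x (hWS₁ hxW)]
    simp [hQ₁v, hQ₂v, hxW, hxW₂, hD₁, hxa, hxb]
  · rw [hMout y (hWS₂ hyW)]
    have hyb : y ≠ b := fun h => hyF (h ▸ hbF)
    simp [hQ₁v, hQ₂v, hyW, hyW₁, hD₂, hya, hyc]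
  · by_cases hvS : v ∈ S
    · exact hMS v hvS
    · rw [hMout v hvS, Finsupp.add_apply, Finsupp.tsub_apply, Finsupp.tsub_apply, hQ₁v, hQ₂v]
      -- Only the apex receives exponents from both sides: `(2 - a₁) + (2 - a₂)`, at most two by
      -- `ha`.
      by_cases hva : v = a
      · subst hva
        have e1 : D₁ v = a₁ := by simp [hD₁, hxa.symm, hab]
        have e2 : D₂ v = a₂ := by simp [hD₂, hya.symm, hac]
        rw [if_pos haW₁, if_pos haW₂, e1, e2]
        omega
      · have := fun h1 h2 => hva (hinter v h1 h2)
        split_ifs with h1 h2 h2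
        · exact absurd h2 (this h1)
        all_goals omega

end OuterplaneEmbedding

end OuterplaneGraph

/-! ### The theorem: locating the exceptional face and choosing exponents -/

theorem theorem13 {V : Type*} [Fintype V] (G : SimpleGraph V)
    (R : OuterplaneGraph.OuterplaneEmbedding G)
    (hconn : OuterplaneGraph.TwoConnected G)
    (r : V → V → Prop) (hr : OuterplaneGraph.IsOrientation G r)
    (x y : V) (hxy : x ≠ y) (hfund : R.IsFundamental x y)
    (F : R.InnerFace) (hF : ¬ R.IsTriangular F)
    (hFunique : ∀ f : R.InnerFace, ¬ R.IsTriangular f → f = F)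
    (hxF : ¬ R.OnInner x F) (hyF : ¬ R.OnInner y F)
    (a b c : V) (habc : R.IsApex F a b c)
    (C : (G.induce (R.remaining F a b c)).Coloring (Fin 3))
    (Cx Cy Ca : Fin 3)
    (hCx : Cx = C ⟨x, R.mem_remaining F a b c hxF⟩)
    (hCy : Cy = C ⟨y, R.mem_remaining F a b c hyF⟩)
    (hCa : Ca = C ⟨a, R.apex_mem_remaining F a b c⟩) :
    ((Cx = Ca ∧ Ca = Cy) →
      OuterplaneGraph.HasMonomial (OuterplaneGraph.graphPolynomial G r) x y 1 1) ∧
    (((Cx ≠ Ca ∧ Ca = Cy) ∨ (Cx = Ca ∧ Ca ≠ Cy)) →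
      OuterplaneGraph.HasMonomial (OuterplaneGraph.graphPolynomial G r) x y 0 1) ∧
    ((Cx ≠ Ca ∧ Ca ≠ Cy) →
      OuterplaneGraph.HasMonomial (OuterplaneGraph.graphPolynomial G r) x y 0 0) := by
  classical
  obtain ⟨hab, hac, hbc, haF, hbF, hcF, f₁, f₂, hf, hFf₁, hFf₂, ha₁, hb₁, ha₂, hc₂⟩ := habc
  have hadj : ¬ G.Adj x y := by
    intro hadj
    have hmem : a ∈ (G.subgraphOfAdj hadj).verts := by
      rw [hfund.1 hadj]
      trivial
    rcases hmem with rfl | rfl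
    · exact hxF haF
    · exact hyF haF
  obtain ⟨g₁, g₂, p, hp, hcover⟩ := hfund.2 hadj
  have hchain := OuterplaneGraph.OuterplaneEmbedding.isFaceChain_getVert p hp hcover
  have hlen : ∀ g : R.InnerFace, 3 ≤ R.faceLength g.1 := by
    intro g
    by_cases hg : R.IsTriangular g
    · exact hg.ge
    · rw [hFunique g hg]
      refine le_trans ?_ (R.ncard_onFace_le F.1)
      rw [← Set.ncard_eq_three.2 ⟨a, b, c, hab, hac, hbc, rfl⟩]
      refine Set.ncard_le_ncard ?_ (Set.toFinite _)
      rintro v (rfl | rfl | rfl)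
      exacts [haF, hbF, hcF]
  have hx₀ : R.OnInner x (p.getVert 0) := by rw [p.getVert_zero]; exact hp.1
  have hyN : R.OnInner y (p.getVert p.length) := by rw [p.getVert_length]; exact hp.2.1
  generalize p.length = N at hchain hyN
  generalize p.getVert = f at hchain hx₀ hyN
  obtain ⟨hall, -⟩ := hchain.tight hlen
  obtain ⟨i, hi, rfl⟩ := hall F
  -- The chain starts at a face of `x` and ends at a face of `y`, so `F` is neither of its ends and
  -- has exactly two neighbours in it.
  have hi₀ : i ≠ 0 := by rintro rfl; exact hxF hx₀
  have hiN : i ≠ N := by rintro rfl; exact hyF hyN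
  obtain ⟨k, rfl⟩ := Nat.exists_eq_succ_of_ne_zero hi₀
  obtain ⟨m, rfl⟩ := Nat.exists_eq_add_of_le (show k + 2 ≤ N by omega)
  change ∀ g, _ → g = f (k + 1) at hFunique
  have htri : ∀ j ≤ k + 2 + m, j ≠ k + 1 → R.IsTriangular (f j) := by
    intro j hj hjk
    by_contra hcon
    exact hjk (hchain.inj j hj (k + 1) (by omega) (hFunique _ hcon))
  have hnbr : ∀ g, R.weakDual.Adj (f (k + 1)) g → g = f k ∨ g = f (k + 2) := by
    intro g hg
    obtain ⟨l, hl, rfl⟩ := hall g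
    have n1 : ¬ l + 2 ≤ k + 1 := fun h => hchain.not_adj l (k + 1) h (by omega) hg.symm
    have n2 : ¬ k + 1 + 2 ≤ l := fun h => hchain.not_adj (k + 1) l h hl hg
    have n3 : l ≠ k + 1 := by rintro rfl; exact hg.1 rfl
    rcases (show l = k ∨ l = k + 2 by omega) with rfl | rfl
    · exact Or.inl rfl
    · exact Or.inr rfl
  -- The default colour is harmless: properness is only needed between remaining vertices.
  set C' : V → ZMod 3 := fun v =>
    if hv : v ∈ R.remaining (f (k + 1)) a b c then C ⟨v, hv⟩ else 0 with hC'
  have hCv : ∀ (v : V) (hv : v ∈ R.remaining (f (k + 1)) a b c), C' v = C ⟨v, hv⟩ := fun v hv =>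
    dif_pos hv
  have hproper : ∀ u v, G.Adj u v → u ∈ R.remaining (f (k + 1)) a b c →
      v ∈ R.remaining (f (k + 1)) a b c → C' u ≠ C' v := by
    intro u v huv hu hv
    rw [hCv u hu, hCv v hv]
    exact C.valid (v := ⟨u, hu⟩) (w := ⟨v, hv⟩) huv
  have hCx' : C' x = Cx := (hCv x _).trans hCx.symm
  have hCy' : C' y = Cy := (hCv y _).trans hCy.symm
  have hCa' : C' a = Ca := (hCv a _).trans hCa.symm
  have hadj_apex : ∀ v, a ≠ v → R.OnInner v (f (k + 1)) →
      (R.OnInner a (f k) ∧ R.OnInner v (f k) ∨ R.OnInner a (f (k + 2)) ∧ R.OnInner v (f (k + 2))) →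
      G.Adj a v := by
    intro v hav hvF hcase
    have hd : ∃ d : G.Dart, d.edge = s(a, v) := by
      rcases hcase with ⟨h1, h2⟩ | ⟨h1, h2⟩
      · obtain ⟨⟨d, -, hd⟩, -⟩ :=
          hchain.exists_shared hlen (j := k) (by omega) hav h1 haF h2 hvF
        exact ⟨d, hd⟩
      · obtain ⟨⟨d, -, hd⟩, -⟩ :=
          hchain.exists_shared hlen (j := k + 1) (by omega) hav haF h1 hvF h2
        exact ⟨d, hd⟩
    obtain ⟨d, hd⟩ := hd
    have := d.edge_mem
    rwa [hd, SimpleGraph.mem_edgeSet] at this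
  -- Either companion may be on the side of `x`. Naming only the colours, `β` towards `x` and `γ`
  -- towards `y`, absorbs this symmetry.
  have key : ∃ β γ : ZMod 3, Ca ≠ β ∧ Ca ≠ γ ∧ ∀ x₁ a₁ b₁ y₂ a₂ c₂ : ℕ,
      x₁ ≤ 2 → a₁ ≤ 2 → b₁ ≤ 2 → y₂ ≤ 2 → a₂ ≤ 2 → c₂ ≤ 2 → x₁ + a₁ + b₁ = 3 →
      y₂ + a₂ + c₂ = 3 → (x₁ * C' x + a₁ * C' a + b₁ * β : ZMod 3) ≠ 0 →
      (y₂ * C' y + a₂ * C' a + c₂ * γ : ZMod 3) ≠ 0 → 2 ≤ a₁ + a₂ →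
      OuterplaneGraph.HasMonomial (OuterplaneGraph.graphPolynomial G r) x y (2 - x₁) (2 - y₂) := by
    have hra : a ∈ R.remaining (f (k + 1)) a b c := fun _ => Or.inl rfl
    have hrb : b ∈ R.remaining (f (k + 1)) a b c := fun _ => Or.inr (Or.inl rfl)
    have hrc : c ∈ R.remaining (f (k + 1)) a b c := fun _ => Or.inr (Or.inr rfl)
    rcases hnbr f₁ hFf₁ with rfl | rfl <;> rcases hnbr f₂ hFf₂ with rfl | rfl
    · exact absurd rfl hf
    · refine ⟨C' b, C' c, ?_, ?_, fun x₁ a₁ b₁ y₂ a₂ c₂ l₁ l₂ l₃ l₄ l₅ l₆ s₁ s₂ t₁ t₂ u => ?_⟩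
      · rw [← hCa']
        exact hproper a b (hadj_apex b hab hbF (Or.inl ⟨ha₁, hb₁⟩)) hra hrb
      · rw [← hCa']
        exact hproper a c (hadj_apex c hac hcF (Or.inr ⟨ha₂, hc₂⟩)) hra hrc
      · exact hchain.hasMonomial hlen hconn.1 htri hF hr hab hac hbc haF hbF hcF ha₁ hb₁ ha₂ hc₂
          hx₀ hyN hxF hyF hproper l₁ l₂ l₃ l₄ l₅ l₆ s₁ s₂ t₁ t₂ u
    · refine ⟨C' c, C' b, ?_, ?_, fun x₁ a₁ b₁ y₂ a₂ c₂ l₁ l₂ l₃ l₄ l₅ l₆ s₁ s₂ t₁ t₂ u => ?_⟩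
      · rw [← hCa']
        exact hproper a c (hadj_apex c hac hcF (Or.inl ⟨ha₂, hc₂⟩)) hra hrc
      · rw [← hCa']
        exact hproper a b (hadj_apex b hab hbF (Or.inr ⟨ha₁, hb₁⟩)) hra hrb
      · have hswap : ∀ v, v ∈ R.remaining (f (k + 1)) a c b → v ∈ R.remaining (f (k + 1)) a b c :=
          fun v hv hvF => (hv hvF).imp_right Or.symm
        exact hchain.hasMonomial hlen hconn.1 htri hF hr hac hab hbc.symm haF hcF hbF ha₂ hc₂ ha₁ hb₁
          hx₀ hyN hxF hyF (fun u v huv hu hv => hproper u v huv (hswap u hu) (hswap v hv))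
          l₁ l₂ l₃ l₄ l₅ l₆ s₁ s₂ t₁ t₂ u
    · exact absurd rfl hf
  obtain ⟨β, γ, hβ, hγ, key⟩ := key
  rw [hCx', hCy', hCa'] at key
  -- In `ZMod 3` each sum equals plus or minus the difference of two colours assumed distinct.
  have twice : ∀ s t u : ZMod 3, s ≠ t → ((2 : ℕ) * s + (1 : ℕ) * t + (0 : ℕ) * u : ZMod 3) ≠ 0 := by
    decide
  have twice' : ∀ s t u : ZMod 3, s ≠ t →
      ((1 : ℕ) * s + (2 : ℕ) * t + (0 : ℕ) * u : ZMod 3) ≠ 0 := by decide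
  have once : ∀ s t u : ZMod 3, s = t → t ≠ u →
      ((1 : ℕ) * s + (1 : ℕ) * t + (1 : ℕ) * u : ZMod 3) ≠ 0 := by decide
  have skip : ∀ s t u : ZMod 3, s = t → t ≠ u →
      ((2 : ℕ) * s + (0 : ℕ) * t + (1 : ℕ) * u : ZMod 3) ≠ 0 := by decide
  -- The numbers passed to `key` are the lowerings of `x`, apex, companion, then of `y`, apex,
  -- companion. When only `y` differs in colour from the apex, the side of `x` leaves the apex alone
  -- and the side of `y` lowers it twice.
  refine ⟨fun ⟨h1, h2⟩ => ?_, ?_, fun ⟨h1, h2⟩ => ?_⟩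
  · exact key 1 1 1 1 1 1 (by decide) (by decide) (by decide) (by decide) (by decide) (by decide)
      rfl rfl (once _ _ _ h1 hβ) (once _ _ _ h2.symm hγ) (by decide)
  · rintro (⟨h1, h2⟩ | ⟨h1, h2⟩)
    · exact key 2 1 0 1 1 1 (by decide) (by decide) (by decide) (by decide) (by decide) (by decide)
        rfl rfl (twice _ _ _ h1) (once _ _ _ h2.symm hγ) (by decide)
    · exact key 2 0 1 1 2 0 (by decide) (by decide) (by decide) (by decide) (by decide) (by decide)
        rfl rfl (skip _ _ _ h1 hβ) (twice' _ _ _ h2.symm) (by decide)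
  · exact key 2 1 0 2 1 0 (by decide) (by decide) (by decide) (by decide) (by decide) (by decide)
      rfl rfl (twice _ _ _ h1) (twice _ _ _ h2.symm) (by decide)
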